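/- A variety is an integral separated scheme of finite type over $\mathbb{C}$, and a torus is an algebraic group over $\mathbb{C}$ isomorphic to $\mathbb{G}_m^n$ for some $n\ge 0$. Let $X$ be a variety with an action $\alpha\colon \mathbb{T}\times_{\mathbb{C}} X\to X$ of a torus $\mathbb{T}$. Let $X^{\mathbb{T}}$ be the fixed point locus, i.e. the maximal closed subscheme $Y\subseteq X$ such that $\alpha|_{\mathbb{T}\times Y}$ is the projection to $Y$. Let $\ker(\mathbb{T}\curvearrowright X)\subseteq\mathbb{T}$ be the kernel of the action, i.e. the maximal closed subscheme $Z\subseteq\mathbb{T}$ such that $\alpha|_{Z\times X}$ is the projection to $X$ (it is a closed subgroup scheme). Define the complexity of the action by $$c(\mathbb{T}\curvearrowright X):=\dim X-\dim\mathbb{T}+\dim\ker(\mathbb{T}\curvearrowright X).$$ Then $$\dim X^{\mathbb{T}}\le c(\mathbb{T}\curvearrowright X),$$ where $\dim$ denotes Krull dimension and $\dim\emptyset=-\infty$. -/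

import Mathlib

open AlgebraicGeometry CategoryTheory MonoidalCategory CartesianMonoidalCategory
open scoped MonObj

namespace TorusAction

/-- The category of schemes over `ℂ`, with fibre products over `Spec ℂ` as tensor products. -/
abbrev SchC : Type 1 := Over (Spec (CommRingCat.of ℂ))

/-- A variety: an integral separated scheme of finite type over `ℂ`. -/
structure IsVariety (X : SchC) : Prop where
  isIntegral : IsIntegral X.left
  isSeparated : IsSeparated X.hom
  locallyOfFiniteType : LocallyOfFiniteType X.hom
  quasiCompact : QuasiCompact X.hom

/-- The multiplicative group `𝔾ₘ = Spec ℂ[x, x⁻¹]`. It is a group object through the Hopf algebra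
structure on Laurent polynomials, in which `x` is group-like. -/
noncomputable abbrev Gm : SchC :=
  (Spec (CommRingCat.of (LaurentPolynomial ℂ))).asOver (Spec (CommRingCat.of ℂ))

/-- A torus: an algebraic group over `ℂ` that is a power of `𝔾ₘ`, that is, it has `n` homomorphisms
to `𝔾ₘ` which exhibit it as the product of `n` copies of `𝔾ₘ` (for some `n ≥ 0`). -/
def IsTorus (T : SchC) [GrpObj T] : Prop :=
  ∃ (n : ℕ) (p : Fin n → (T ⟶ Gm)),
    (∀ i, IsMonHom (p i)) ∧ Nonempty (Limits.IsLimit (Limits.Fan.mk T p))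

/-- The closed subscheme of `X` cut out by an ideal sheaf, as a scheme over `ℂ`. -/
noncomputable def closedSubscheme {X : SchC} (I : X.left.IdealSheafData) : SchC :=
  Over.mk (I.subschemeι ≫ X.hom)

/-- The inclusion of a closed subscheme. -/
noncomputable def closedInclusion {X : SchC} (I : X.left.IdealSheafData) : closedSubscheme I ⟶ X :=
  Over.homMk I.subschemeι rfl

/-- The closed subscheme `Y ⊆ X` cut out by `I` is `T`-invariant: the action restricted to `T × Y`
factors through `Y`, and the induced map `T × Y ⟶ Y` is the projection. -/
def IsInvariant (T X : SchC) [GrpObj T] [ModObj T X] (I : X.left.IdealSheafData) : Prop :=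
  ∃ β : T ⊗ closedSubscheme I ⟶ closedSubscheme I,
    β ≫ closedInclusion I = T ◁ closedInclusion I ≫ (γ[T, X] : T ⊗ X ⟶ X) ∧
      β = snd T (closedSubscheme I)

/-- The fixed point locus `X^T`: the maximal `T`-invariant closed subscheme of `X`. Larger closed
subschemes have smaller ideal sheaves, so it is cut out by the infimum of the ideal sheaves of all
`T`-invariant closed subschemes. -/
noncomputable def fixedLocus (T X : SchC) [GrpObj T] [ModObj T X] : SchC :=
  closedSubscheme (sInf {I : X.left.IdealSheafData | IsInvariant T X I})

/-- The closed subscheme `Z ⊆ T` cut out by `I` acts trivially on `X`: the action restricted to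
`Z × X` is the projection to `X`. -/
def ActsTrivially (T X : SchC) [GrpObj T] [ModObj T X] (I : T.left.IdealSheafData) : Prop :=
  closedInclusion I ▷ X ≫ (γ[T, X] : T ⊗ X ⟶ X) = snd (closedSubscheme I) X

/-- The kernel of the action: the maximal closed subscheme of `T` that acts trivially on `X`. -/
noncomputable def actionKernel (T X : SchC) [GrpObj T] [ModObj T X] : SchC :=
  closedSubscheme (sInf {I : T.left.IdealSheafData | ActsTrivially T X I})

/-- The (Krull) dimension of a scheme over `ℂ` as an extended real, equal to `-∞` for the empty
scheme. -/
noncomputable def dim (X : SchC) : EReal :=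
  WithBot.recBotCoe ⊥ (fun d : ℕ∞ => ((d : ENNReal) : EReal)) (topologicalKrullDim X.left)

/-- The complexity `c(T ↻ X) = dim X - dim T + dim ker(T ↻ X)` of an action. -/
noncomputable def complexity (T X : SchC) [GrpObj T] [ModObj T X] : EReal :=
  dim X - dim T + dim (actionKernel T X)

end TorusAction

/-! Let x be a point of X^T, not necessarily closed, with local ring A and maximal ideal m, and let
n = dim T. It suffices to find a subtorus of codimension b ≤ dim A acting trivially on X: then dim
ker ≥ n - b, while the closure of x has dimension at most dim X - dim A.

Since x is fixed together with its residue field, T × Spec (A/m^k) maps to the single point x, so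
the action gives a coaction A → (A/m^k)[ℤ^n]. Hence the points of T act on A, trivially on the
residue field, and every element is a sum of weight vectors modulo m^k
(`LocalChart.exists_weightAction`).

The key is `WeightAction.exists_linearIndepOn_card_le`. Embed A in a valuation ring V with a nonunit
u that divides m and has cofinal powers. Call a weight visible if a weight vector modulo some m^k
divides u^l in V for some l < k. Given b independent visible weights, the monomials with exponents
below K in their weight vectors have K^b distinct weights and are nonzero modulo m^(KΛ+1), for a
constant Λ. The length of A/m^k bounds the number of weights and is O(k^(dim A)), so b ≤ dim A.
Conversely, if all visible weights are trivial at t, then t moves every f by a multiple of every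
u^k, hence not at all.

The subtorus on which the visible weights vanish therefore acts trivially on Spec A, which is dense
in X, so its points fix X. As its product with X is reduced, it lies in the kernel. -/

namespace TorusAction

universe u

/-! ### Valuation rings over a Noetherian domain -/

section ExtendedRees

open LaurentPolynomial

variable {A : Type*} [CommRing A]

/-- The Laurent polynomials whose coefficient in degree `k` lies in `I ^ k`. -/
noncomputable def powCoeffSubalgebra (I : Ideal A) : Subalgebra A A[T;T⁻¹] where
  carrier := {p | ∀ k : ℤ, p.coeff k ∈ I ^ k.toNat}
  mul_mem' {p q} hp hq k := by
    classical
    rw [AddMonoidAlgebra.coeff_mul]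
    refine Ideal.sum_mem _ fun i _ => Ideal.sum_mem _ fun j _ => ?_
    dsimp only
    split_ifs with h
    · refine Ideal.pow_le_pow_right (show k.toNat ≤ i.toNat + j.toNat by omega) ?_
      rw [pow_add]
      exact Ideal.mul_mem_mul (hp i) (hq j)
    · exact zero_mem _
  add_mem' {p q} hp hq k := by
    rw [AddMonoidAlgebra.coeff_add]
    exact add_mem (hp k) (hq k)
  algebraMap_mem' r k := by
    classical
    rw [LaurentPolynomial.algebraMap_apply, ← LaurentPolynomial.single_eq_C,
      AddMonoidAlgebra.coeff_single, Finsupp.single_apply]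
    split_ifs with h
    · subst h; simp
    · exact zero_mem _

/-- If `A` is a Noetherian domain and `I` a proper ideal, the extended Rees algebra of `I` is a
Noetherian domain over `A` with a nonzero nonunit `u` that divides the elements of `I`. -/
theorem exists_extendedRees {A : Type u} [CommRing A] [IsDomain A] [IsNoetherianRing A]
    (I : Ideal A) (hI : I ≠ ⊤) :
    ∃ (S : Subalgebra A A[T;T⁻¹]) (u : S), IsNoetherianRing S ∧ u ≠ 0 ∧ ¬ IsUnit u ∧
      ∀ a ∈ I, u ∣ algebraMap A S a := by
  classical
  obtain ⟨s, hs⟩ := IsNoetherian.noetherian I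
  let gens : Finset A[T;T⁻¹] := insert (T (-1)) (s.image fun a => C a * T 1)
  let S : Subalgebra A A[T;T⁻¹] := Algebra.adjoin A gens
  have hu : (T (-1) : A[T;T⁻¹]) ∈ S := Algebra.subset_adjoin (by simp [gens])
  -- This inclusion shows that the inverse of `T (-1)` is not in `S`: the coefficient 1 of `T 1` in
  -- degree 1 would have to lie in `I`.
  have hle : S ≤ powCoeffSubalgebra I := by
    refine Algebra.adjoin_le fun x hx => ?_
    rw [Finset.mem_coe, Finset.mem_insert, Finset.mem_image] at hx
    rcases hx with rfl | ⟨a, ha, rfl⟩ <;> intro k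
    · rw [T, AddMonoidAlgebra.coeff_single, Finsupp.single_apply]
      split_ifs with h
      · subst h; simp
      · exact zero_mem _
    · rw [← single_eq_C_mul_T, AddMonoidAlgebra.coeff_single, Finsupp.single_apply]
      split_ifs with h
      · subst h
        simpa using hs ▸ Ideal.subset_span ha
      · exact zero_mem _
  refine ⟨S, ⟨T (-1), hu⟩, ?_, ?_, ?_, ?_⟩
  · have : Algebra.FiniteType A S := S.fg_iff_finiteType.mp ⟨gens, rfl⟩
    exact Algebra.FiniteType.isNoetherianRing A S
  · intro h
    have h1 : (T (-1) : A[T;T⁻¹]) = 0 := congrArg Subtype.val h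
    exact (isUnit_T (R := A) (-1)).ne_zero h1
  · intro h
    obtain ⟨v, hv⟩ := isUnit_iff_exists_inv.mp h
    have h1 : (T (-1) : A[T;T⁻¹]) * v.1 = 1 := congrArg Subtype.val hv
    have h2 : v.1 = T 1 := by
      have h3 : (T 1 : A[T;T⁻¹]) * T (-1) = 1 := by rw [← T_add]; simp
      calc v.1 = (T 1 * T (-1)) * v.1 := by rw [h3, one_mul]
        _ = T 1 := by rw [mul_assoc, h1, mul_one]
    have h4 := hle v.2 1
    rw [h2, T, AddMonoidAlgebra.coeff_single, Finsupp.single_eq_same] at h4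
    exact hI ((Ideal.eq_top_iff_one _).mpr (by simpa using h4))
  · intro a ha
    rw [← hs] at ha
    induction ha using Submodule.span_induction with
    | mem x hx =>
      refine ⟨⟨C x * T 1, Algebra.subset_adjoin ?_⟩, Subtype.ext ?_⟩
      · simp only [gens, Finset.coe_insert, Finset.coe_image]
        exact Or.inr ⟨x, hx, rfl⟩
      · change C x = T (-1) * (C x * T 1)
        rw [mul_left_comm, ← T_add]
        simp
    | zero => simp
    | add x y _ _ hx hy => rw [map_add]; exact dvd_add hx hy
    | smul r x _ hx => rw [smul_eq_mul, map_mul]; exact hx.mul_left _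

end ExtendedRees

/-- A local domain in which the powers of a nonunit `u` are cofinal is dominated by a valuation ring
in which the powers of `u` are cofinal. -/
theorem exists_valuationSubring_of_cofinal {O : Type u} [CommRing O] [IsDomain O] [IsLocalRing O]
    {u : O} (hu : ¬ IsUnit u) (hcof : ∀ c : O, c ≠ 0 → ∃ l : ℕ, c ∣ u ^ l) :
    ∃ (K : Type u) (_ : Field K) (V : ValuationSubring K) (φ : O →+* V),
      Function.Injective φ ∧ ¬ IsUnit (φ u) ∧ ∀ x : V, x ≠ 0 → ∃ l : ℕ, x ∣ φ u ^ l := by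
  obtain ⟨V, h, hV⟩ := IsLocalRing.exists_factor_valuationRing (algebraMap O (FractionRing O))
  let ψ : O →+* V := (algebraMap O (FractionRing O)).codRestrict V.toSubring h
  have hψ : ∀ o, (ψ o : FractionRing O) = algebraMap O (FractionRing O) o := fun _ => rfl
  refine ⟨FractionRing O, inferInstance, V, ψ, fun x y hxy => ?_, ?_, ?_⟩
  · exact IsFractionRing.injective O (FractionRing O) (congrArg Subtype.val hxy)
  · exact fun hunit => hu (hV.map_nonunit _ hunit)
  · intro x hx
    obtain ⟨c, d, hd, hcd⟩ := IsFractionRing.div_surjective (A := O) (x : FractionRing O)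
    have hd0 : algebraMap O (FractionRing O) d ≠ 0 := by
      simpa using nonZeroDivisors.ne_zero hd
    have hc0 : c ≠ 0 := by
      rintro rfl
      exact hx (Subtype.ext (by simpa using hcd.symm))
    obtain ⟨l, e, he⟩ := hcof c hc0
    refine ⟨l, ψ (d * e), Subtype.ext ?_⟩
    have h1 : (x : FractionRing O) * algebraMap O (FractionRing O) d =
        algebraMap O (FractionRing O) c := by
      rw [← hcd, div_mul_cancel₀ _ hd0]
    have h2 : ((ψ u ^ l : V) : FractionRing O) = algebraMap O (FractionRing O) (u ^ l) := by
      rw [← map_pow, hψ]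
    rw [h2, he, map_mul, ← h1, MulMemClass.coe_mul, hψ, map_mul, mul_assoc]

/-- A Noetherian domain with a nonzero nonunit `u` embeds into a valuation ring in which `u` is a
nonunit with cofinal powers. -/
theorem exists_valuationSubring_of_not_isUnit {S : Type u} [CommRing S] [IsDomain S]
    [IsNoetherianRing S] {u : S} (hu : ¬ IsUnit u) :
    ∃ (K : Type u) (_ : Field K) (V : ValuationSubring K) (φ : S →+* V),
      Function.Injective φ ∧ ¬ IsUnit (φ u) ∧ ∀ x : V, x ≠ 0 → ∃ l : ℕ, x ∣ φ u ^ l := by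
  -- By Krull's principal ideal theorem the localization at `Q` has dimension at most 1. Its only
  -- possible nonzero prime is the maximal ideal, which contains `u`, so `u` is in the radical of
  -- every nonzero ideal.
  obtain ⟨Q, hQ⟩ := (Ideal.span {u}).nonempty_minimalPrimes (by simpa [Ideal.span_singleton_eq_top])
  have := hQ.isPrime
  have huQ : u ∈ Q := hQ.1.2 (Ideal.mem_span_singleton_self u)
  let O := Localization.AtPrime Q
  have : IsDomain O := IsLocalization.isDomain_localization Q.primeCompl_le_nonZeroDivisors
  have hdim : Ring.KrullDimLE 1 O := by
    rw [Ring.krullDimLE_iff, IsLocalization.AtPrime.ringKrullDim_eq_height Q O]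
    exact_mod_cast Ideal.height_le_one_of_isPrincipal_of_mem_minimalPrimes _ Q hQ
  have hinj : Function.Injective (algebraMap S O) :=
    IsLocalization.injective O Q.primeCompl_le_nonZeroDivisors
  have huO : algebraMap S O u ∈ IsLocalRing.maximalIdeal O := by
    rwa [IsLocalization.AtPrime.to_map_mem_maximal_iff O Q]
  have hcof : ∀ c : O, c ≠ 0 → ∃ l : ℕ, c ∣ algebraMap S O u ^ l := by
    intro c hc
    have : algebraMap S O u ∈ (Ideal.span {c}).radical := by
      rw [Ideal.radical_eq_sInf, Ideal.mem_sInf]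
      rintro P ⟨hcP, hP⟩
      have hP0 : P ≠ ⊥ := by
        rintro rfl
        exact hc (by simpa using hcP (Ideal.mem_span_singleton_self c))
      have := Ring.krullDimLE_one_iff_of_noZeroDivisors.mp hdim P hP0 hP
      rwa [IsLocalRing.eq_maximalIdeal this]
    obtain ⟨l, hl⟩ := this
    exact ⟨l, Ideal.mem_span_singleton.mp hl⟩
  obtain ⟨K, _, V, ψ, hψ, hψu, hV⟩ := exists_valuationSubring_of_cofinal huO hcof
  exact ⟨K, _, V, ψ.comp (algebraMap S O), hψ.comp hinj, hψu, hV⟩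

/-- A Noetherian domain embeds into a valuation ring with an element `u` whose powers are cofinal
and which divides all elements of a given proper ideal. -/
theorem exists_valuationSubring_dvd {A : Type u} [CommRing A] [IsDomain A] [IsNoetherianRing A]
    (I : Ideal A) (hI : I ≠ ⊤) :
    ∃ (K : Type u) (_ : Field K) (V : ValuationSubring K) (φ : A →+* V) (u : V),
      Function.Injective φ ∧ u ≠ 0 ∧ ¬ IsUnit u ∧ (∀ a ∈ I, u ∣ φ a) ∧
      ∀ x : V, x ≠ 0 → ∃ l : ℕ, x ∣ u ^ l := by
  obtain ⟨S, u, hS, hu0, hu, hdvd⟩ := exists_extendedRees I hI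
  obtain ⟨K, _, V, φ, hφ, hφu, hcof⟩ := exists_valuationSubring_of_not_isUnit hu
  refine ⟨K, _, V, φ.comp (algebraMap A S), φ u, hφ.comp ?_, ?_, hφu, ?_, hcof⟩
  · intro x y hxy
    have h : (AddMonoidAlgebra.single 0 x : LaurentPolynomial A) = AddMonoidAlgebra.single 0 y :=
      congrArg Subtype.val hxy
    simpa using congrArg (fun p => AddMonoidAlgebra.coeff p 0) h
  · rwa [Ne, map_eq_zero_iff φ hφ]
  · exact fun a ha => map_dvd φ (hdvd a ha)

/-! ### Lengths of quotients of a local ring -/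

section Length

variable {A : Type*} [CommRing A]

/-- If multiplication by `y` maps `I₂` into `I₁` and `I₀ ≤ I₁ + (y)`, then the length of `A ⧸ I₁` is
at most the sum of those of `A ⧸ I₀` and `A ⧸ I₂`. -/
theorem length_quotient_le_add {I₀ I₁ I₂ : Ideal A} {y : A}
    (h₀ : I₀ ≤ I₁ ⊔ Ideal.span {y}) (h₂ : ∀ a ∈ I₂, y * a ∈ I₁) :
    Module.length A (A ⧸ I₁) ≤ Module.length A (A ⧸ I₀) + Module.length A (A ⧸ I₂) := by
  -- The image of `f` is a quotient of `A ⧸ I₂`, and its cokernel `A ⧸ (I₁ + (y))` is a quotient of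
  -- `A ⧸ I₀`.
  let f : (A ⧸ I₂) →ₗ[A] (A ⧸ I₁) := Submodule.mapQ I₂ I₁ (LinearMap.mulLeft A y) h₂
  have hex := Module.length_eq_add_of_exact f.range.subtype f.range.mkQ
    f.range.injective_subtype f.range.mkQ_surjective
    (by rw [LinearMap.exact_iff, Submodule.ker_mkQ, Submodule.range_subtype])
  rw [hex, add_comm]
  refine add_le_add ?_ (Module.length_le_of_surjective f.rangeRestrict f.surjective_rangeRestrict)
  let g : (A ⧸ I₀) →ₗ[A] ((A ⧸ I₁) ⧸ f.range) :=
    Submodule.liftQ I₀ (f.range.mkQ.comp I₁.mkQ) (by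
      refine h₀.trans (sup_le ?_ ?_)
      · intro a ha
        have : I₁.mkQ a = 0 := (Submodule.Quotient.mk_eq_zero _).mpr ha
        simp [LinearMap.mem_ker, this]
      · rw [Ideal.span_le, Set.singleton_subset_iff, SetLike.mem_coe, LinearMap.mem_ker,
          LinearMap.comp_apply, Submodule.mkQ_apply, Submodule.Quotient.mk_eq_zero]
        refine ⟨I₂.mkQ 1, ?_⟩
        change Submodule.Quotient.mk (y * 1) = _
        rw [mul_one]
        rfl)
  refine Module.length_le_of_surjective g ?_
  intro z
  obtain ⟨z, rfl⟩ := f.range.mkQ_surjective z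
  obtain ⟨z, rfl⟩ := I₁.mkQ_surjective z
  exact ⟨I₀.mkQ z, rfl⟩

theorem length_quotient_sup_span_pow_le (J : Ideal A) (x : A) (k : ℕ) :
    Module.length A (A ⧸ (J ⊔ Ideal.span {x ^ k})) ≤
      k * Module.length A (A ⧸ (J ⊔ Ideal.span {x})) := by
  induction k with
  | zero =>
    have : Subsingleton (A ⧸ (J ⊔ Ideal.span {x ^ 0})) := by
      rw [Ideal.Quotient.subsingleton_iff]
      simp
    rw [Module.length_eq_zero]
    exact zero_le
  | succ k ih =>
    refine (length_quotient_le_add (I₀ := J ⊔ Ideal.span {x ^ k}) (y := x ^ k)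
      (I₂ := J ⊔ Ideal.span {x}) ?_ ?_).trans ?_
    · exact sup_le (le_sup_left.trans le_sup_left) le_sup_right
    · intro a ha
      obtain ⟨b, hb, c, hc, rfl⟩ := Submodule.mem_sup.mp ha
      obtain ⟨e, rfl⟩ := Ideal.mem_span_singleton.mp hc
      rw [mul_add]
      refine add_mem (Ideal.mem_sup_left (Ideal.mul_mem_left _ _ hb)) (Ideal.mem_sup_right ?_)
      rw [← mul_assoc, ← pow_succ]
      exact Ideal.mul_mem_right _ _ (Ideal.mem_span_singleton_self _)
    · push_cast
      rw [add_mul, one_mul]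
      gcongr

/-- The generators are replaced by their powers one at a time, each costing a factor `k`. -/
theorem length_quotient_sup_span_image_pow_le [DecidableEq A] (s : Finset A) (J : Ideal A) (k : ℕ) :
    Module.length A (A ⧸ (J ⊔ Ideal.span ((· ^ k) '' (s : Set A)))) ≤
      k ^ s.card * Module.length A (A ⧸ (J ⊔ Ideal.span (s : Set A))) := by
  induction s using Finset.induction_on generalizing J with
  | empty =>
    have h : (· ^ k) '' ((∅ : Finset A) : Set A) = ((∅ : Finset A) : Set A) := by simp
    rw [h, Finset.card_empty, pow_zero, one_mul]
  | insert x s hx ih =>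
    rw [Finset.coe_insert, Set.image_insert_eq, Ideal.span_insert, ← sup_assoc,
      Finset.card_insert_of_notMem hx]
    refine (ih _).trans ?_
    rw [pow_succ, mul_assoc]
    gcongr
    rw [sup_right_comm, Ideal.span_insert, sup_comm (Ideal.span {x}), ← sup_assoc]
    exact length_quotient_sup_span_pow_le _ _ _

/-- In a Noetherian local ring of dimension `d`, the length of `A ⧸ m ^ k` is `O(k ^ d)`. -/
theorem exists_length_quotient_maximalIdeal_pow_le [IsLocalRing A] [IsNoetherianRing A] :
    ∃ C d : ℕ, (d : WithBot ℕ∞) = ringKrullDim A ∧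
      ∀ k : ℕ, Module.length A (A ⧸ IsLocalRing.maximalIdeal A ^ k) ≤ (C * k ^ d : ℕ) := by
  classical
  -- `s` is a system of parameters. Since m^k contains the k-th powers of its elements, the constant
  -- `C` can be the length of `A ⧸ (s)`.
  obtain ⟨s, hs, hcard⟩ := Ideal.exists_finset_card_eq_height_of_isNoetherianRing
    (IsLocalRing.maximalIdeal A)
  have : IsArtinianRing (A ⧸ Ideal.span (s : Set A)) :=
    IsLocalRing.quotient_artinian_of_mem_minimalPrimes_of_isLocalRing _ hs
  have hfin : Module.length A (A ⧸ Ideal.span (s : Set A)) ≠ ⊤ := by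
    rw [Module.length_eq_of_surjective (S := A) (R := A ⧸ Ideal.span (s : Set A))
      (M := A ⧸ Ideal.span (s : Set A)) Ideal.Quotient.mk_surjective]
    exact Module.length_ne_top
  obtain ⟨C, hC⟩ := ENat.ne_top_iff_exists.mp hfin
  refine ⟨C, s.card, ?_, fun k => ?_⟩
  · rw [← IsLocalRing.maximalIdeal_height_eq_ringKrullDim, ← hcard]
    rfl
  · have hle : (⊥ : Ideal A) ⊔ Ideal.span ((· ^ k) '' (s : Set A)) ≤
        IsLocalRing.maximalIdeal A ^ k := by
      rw [bot_sup_eq, Ideal.span_le]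
      rintro _ ⟨x, hx, rfl⟩
      exact Ideal.pow_mem_pow (hs.1.2 (Ideal.subset_span hx)) k
    refine (Module.length_le_of_surjective (Submodule.factor hle)
      (Submodule.factor_surjective hle)).trans ?_
    refine (length_quotient_sup_span_image_pow_le s ⊥ k).trans ?_
    rw [bot_sup_eq, ← hC, mul_comm]
    push_cast
    rfl

/-- If the elements `f i` of `I` are linearly independent over the residue field modulo `J`, there
are at most `length (A ⧸ J) - length (A ⧸ I)` of them. -/
theorem length_quotient_add_card_le [IsLocalRing A] {I J : Ideal A} (hJI : J ≤ I) {κ : Type*}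
    [Fintype κ] (f : κ → A) (hf : ∀ i, f i ∈ I)
    (hind : ∀ a : κ → A, ∑ i, a i * f i ∈ J → ∀ i, a i ∈ IsLocalRing.maximalIdeal A) :
    Module.length A (A ⧸ I) + Fintype.card κ ≤ Module.length A (A ⧸ J) := by
  let F : (κ → A) →ₗ[A] (A ⧸ J) := J.mkQ.comp (Fintype.linearCombination A f)
  have hF : ∀ a, F a = J.mkQ (∑ i, a i * f i) := fun a => rfl
  let π : (κ → A) →ₗ[A] (κ → A ⧸ IsLocalRing.maximalIdeal A) :=
    LinearMap.pi fun i => (IsLocalRing.maximalIdeal A).mkQ.comp (LinearMap.proj i)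
  have hπ : Function.Surjective π := by
    intro b
    choose a ha using fun i => (IsLocalRing.maximalIdeal A).mkQ_surjective (b i)
    exact ⟨a, funext ha⟩
  -- Reduction of the coefficients modulo the maximal ideal thus factors through the image of `F`, a
  -- submodule of `I ⧸ J`, whose length is therefore at least `card κ`.
  have hker : LinearMap.ker F.rangeRestrict ≤ LinearMap.ker π := by
    intro a ha
    rw [LinearMap.ker_rangeRestrict, LinearMap.mem_ker, hF, Submodule.mkQ_apply,
      Submodule.Quotient.mk_eq_zero] at ha
    rw [LinearMap.mem_ker]
    exact funext fun i => (Submodule.Quotient.mk_eq_zero _).mpr (hind a ha i)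
  have h1 : (Fintype.card κ : ℕ∞) ≤ Module.length A F.range := by
    let e := F.rangeRestrict.quotKerEquivOfSurjective F.surjective_rangeRestrict
    rw [← e.length_eq]
    have h := Module.length_le_of_surjective (Submodule.liftQ _ π hker)
      (fun b => by obtain ⟨a, rfl⟩ := hπ b; exact ⟨Submodule.Quotient.mk a, rfl⟩)
    refine le_trans (le_of_eq ?_) h
    rw [Module.length_pi]
    have : Module.length A (A ⧸ IsLocalRing.maximalIdeal A) = 1 := by
      rw [Module.length_eq_one_iff, isSimpleModule_iff_isCoatom]
      exact (IsLocalRing.maximalIdeal.isMaximal A).out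
    rw [this]
    simp
  have hex := Module.length_eq_add_of_exact F.range.subtype F.range.mkQ
    F.range.injective_subtype F.range.mkQ_surjective
    (by rw [LinearMap.exact_iff, Submodule.ker_mkQ, Submodule.range_subtype])
  rw [hex, add_comm]
  refine add_le_add h1 ?_
  have hle : F.range ≤ LinearMap.ker (Submodule.factor hJI) := by
    rintro _ ⟨a, rfl⟩
    rw [LinearMap.mem_ker, hF]
    exact (Submodule.Quotient.mk_eq_zero _).mpr
      (Ideal.sum_mem _ fun i _ => Ideal.mul_mem_left _ _ (hf i))
  refine Module.length_le_of_surjective (Submodule.liftQ _ (Submodule.factor hJI) hle) ?_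
  intro b
  obtain ⟨a, rfl⟩ := Submodule.factor_surjective hJI b
  exact ⟨Submodule.Quotient.mk a, rfl⟩

end Length

/-! ### Weight vectors modulo powers of the maximal ideal -/

/-- An action of a group `G` by algebra endomorphisms on a local `ℂ`-algebra, trivial on the residue
field, that is diagonalizable modulo each power of the maximal ideal, with weights in `M`. -/
structure WeightAction (G M A : Type*) [Monoid G] [AddCommGroup M] [CommRing A] [IsLocalRing A]
    [Algebra ℂ A] where
  act : G → A →ₐ[ℂ] A
  chr : M → G →* ℂ
  act_one : ∀ f, act 1 f = f
  act_mul : ∀ t s f, act (t * s) f = act s (act t f)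
  chr_zero : ∀ t, chr 0 t = 1
  chr_add : ∀ m n t, chr (m + n) t = chr m t * chr n t
  chr_injective : Function.Injective chr
  exists_expansion : ∀ (f : A) (k : ℕ), ∃ (S : Finset M) (c : M → A), ∀ t,
    act t f - ∑ m ∈ S, chr m t • c m ∈ IsLocalRing.maximalIdeal A ^ k
  act_sub_mem : ∀ t f, act t f - f ∈ IsLocalRing.maximalIdeal A

namespace WeightAction

variable {G M A : Type*} [Monoid G] [AddCommGroup M] [CommRing A] [IsLocalRing A] [Algebra ℂ A]
  (r : WeightAction G M A)

/-- `f` is a weight vector of weight `m` modulo the `k`-th power of the maximal ideal. -/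
def IsWeight (k : ℕ) (m : M) (f : A) : Prop :=
  ∀ t, r.act t f - r.chr m t • f ∈ IsLocalRing.maximalIdeal A ^ k

variable {r}

/-- Dedekind's independence of characters, applied after each ℂ-linear functional on `A ⧸ I`. -/
theorem mem_of_sum_smul_mem (I : Ideal A) (S : Finset M) (a : M → A)
    (h : ∀ t, ∑ m ∈ S, r.chr m t • a m ∈ I) : ∀ m ∈ S, a m ∈ I := by
  intro m hm
  rw [← Ideal.Quotient.eq_zero_iff_mem, ← Module.forall_dual_apply_eq_zero_iff ℂ]
  intro φ
  have hind := linearIndependent_iff'.mp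
    ((linearIndependent_monoidHom G ℂ).comp r.chr r.chr_injective) S
    (fun m => φ (Ideal.Quotient.mk I (a m))) ?_ m hm
  · exact hind
  · funext t
    have h1 := congrArg φ (Ideal.Quotient.eq_zero_iff_mem.mpr (h t))
    have h2 : ∀ m, Ideal.Quotient.mk I (r.chr m t • a m) = r.chr m t • Ideal.Quotient.mk I (a m) :=
      fun _ => rfl
    simp only [map_sum, h2, map_smul, map_zero] at h1
    simpa [mul_comm] using h1

theorem act_mem_pow {f : A} {k : ℕ} (hf : f ∈ IsLocalRing.maximalIdeal A ^ k) (t : G) :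
    r.act t f ∈ IsLocalRing.maximalIdeal A ^ k := by
  have h : Ideal.map (r.act t) (IsLocalRing.maximalIdeal A) ≤ IsLocalRing.maximalIdeal A := by
    rw [Ideal.map_le_iff_le_comap]
    intro a ha
    rw [Ideal.mem_comap, ← sub_add_cancel (r.act t a) a]
    exact add_mem (r.act_sub_mem t a) ha
  have h2 := Ideal.mem_map_of_mem (r.act t) hf
  rw [Ideal.map_pow] at h2
  exact Ideal.pow_right_mono h k h2

theorem IsWeight.mono {k l : ℕ} {m : M} {f : A} (h : r.IsWeight k m f) (hl : l ≤ k) :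
    r.IsWeight l m f :=
  fun t => Ideal.pow_le_pow_right hl (h t)

theorem IsWeight.mul {k : ℕ} {m n : M} {f g : A} (hf : r.IsWeight k m f) (hg : r.IsWeight k n g) :
    r.IsWeight k (m + n) (f * g) := by
  intro t
  have h : r.act t (f * g) - r.chr (m + n) t • (f * g) =
      r.act t g * (r.act t f - r.chr m t • f) + (r.chr m t • f) * (r.act t g - r.chr n t • g) := by
    rw [map_mul, r.chr_add, mul_smul, Algebra.smul_def, Algebra.smul_def, Algebra.smul_def,
      Algebra.smul_def]
    ring
  rw [h]
  exact add_mem (Ideal.mul_mem_left _ _ (hf t)) (Ideal.mul_mem_left _ _ (hg t))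

theorem IsWeight.one (k : ℕ) : r.IsWeight k 0 1 := by
  intro t
  simp [r.chr_zero]

-- Expanding `act (t * s) f` directly, or applying `act s` to the expansion of `act t f`, gives two
-- combinations of the characters of `t`; equating coefficients shows that each `c m` is a weight
-- vector.
variable (r) in
theorem exists_isWeight_expansion (f : A) (k : ℕ) : ∃ (S : Finset M) (c : M → A),
    (∀ m ∈ S, r.IsWeight k m (c m)) ∧ f - ∑ m ∈ S, c m ∈ IsLocalRing.maximalIdeal A ^ k := by
  obtain ⟨S, c, hc⟩ := r.exists_expansion f k
  refine ⟨S, c, ?_, ?_⟩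
  · intro m hm s
    refine mem_of_sum_smul_mem (r := r) _ S (fun m => r.act s (c m) - r.chr m s • c m) ?_ m hm
    intro t
    have h1 := hc (t * s)
    have h2 := act_mem_pow (r := r) (hc t) s
    rw [r.act_mul] at h1
    rw [map_sub, map_sum] at h2
    have h3 := sub_mem h1 h2
    rw [sub_sub_sub_cancel_left, ← Finset.sum_sub_distrib] at h3
    convert h3 using 2 with n
    rw [map_smul, map_mul, smul_sub, smul_smul]
  · have := hc 1
    simpa [r.act_one] using this

/-- The lift is the component of weight `m` in an expansion of `f` to order `l`, taken to be zero if
`m` does not occur. -/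
theorem IsWeight.exists_lift {k l : ℕ} {m : M} {f : A} (h : r.IsWeight k m f) (hkl : k ≤ l) :
    ∃ g, r.IsWeight l m g ∧ f - g ∈ IsLocalRing.maximalIdeal A ^ k := by
  classical
  obtain ⟨S, c, hc, hf⟩ := r.exists_isWeight_expansion f l
  let c' : M → A := fun n => if n ∈ S then c n else 0
  have hc' : ∀ n, r.IsWeight l n (c' n) := by
    intro n
    by_cases hn : n ∈ S
    · simpa [c', hn] using hc n hn
    · intro t
      simp [c', hn]
  refine ⟨c' m, hc' m, ?_⟩
  have hsum : f - ∑ n ∈ insert m S, c' n ∈ IsLocalRing.maximalIdeal A ^ k := by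
    refine Ideal.pow_le_pow_right hkl ?_
    convert hf using 2
    rw [← Finset.sum_subset (Finset.subset_insert m S)]
    · exact Finset.sum_congr rfl fun n hn => by simp [c', hn]
    · intro n _ hn
      simp [c', hn]
  have key := mem_of_sum_smul_mem (r := r) (IsLocalRing.maximalIdeal A ^ k) (insert m S)
    (fun n => (if n = m then f else 0) - c' n) ?_ m (Finset.mem_insert_self _ _)
  · simpa using key
  · intro t
    have h1 := act_mem_pow (r := r) hsum t
    rw [map_sub, map_sum] at h1
    have h2 : ∑ n ∈ insert m S, (r.act t (c' n) - r.chr n t • c' n) ∈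
        IsLocalRing.maximalIdeal A ^ k :=
      Ideal.sum_mem _ fun n _ => Ideal.pow_le_pow_right hkl (hc' n t)
    rw [Finset.sum_sub_distrib] at h2
    have h3 := sub_mem (add_mem h1 h2) (h t)
    have h4 : ∑ n ∈ insert m S, r.chr n t • ((if n = m then f else 0) - c' n) =
        r.chr m t • f - ∑ n ∈ insert m S, r.chr n t • c' n := by
      simp [smul_sub, Finset.sum_sub_distrib]
    rw [h4]
    convert h3 using 1
    abel

/-- The weights occurring modulo the `k`-th power of the maximal ideal are at most as many as the
length of the quotient. -/
theorem card_le_length (k : ℕ) (S : Finset M)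
    (hS : ∀ m ∈ S, ∃ f, r.IsWeight k m f ∧ f ∉ IsLocalRing.maximalIdeal A ^ k) :
    (S.card : ℕ∞) ≤ Module.length A (A ⧸ IsLocalRing.maximalIdeal A ^ k) := by
  classical
  induction k generalizing S with
  | zero =>
    have : S = ∅ := by
      rw [Finset.eq_empty_iff_forall_notMem]
      intro m hm
      obtain ⟨f, _, hf⟩ := hS m hm
      simp at hf
    simp [this]
  | succ k ih =>
    choose! f hf hfk using hS
    have h1 := ih (S.filter fun m => f m ∉ IsLocalRing.maximalIdeal A ^ k) (by
      intro m hm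
      rw [Finset.mem_filter] at hm
      exact ⟨f m, (hf m hm.1).mono k.le_succ, hm.2⟩)
    -- The remaining weight vectors lie in m^k but not in m^(k+1). They are independent in
    -- m^k/m^(k+1) over the residue field, because their weights differ.
    let S₂ := S.filter fun m => ¬ f m ∉ IsLocalRing.maximalIdeal A ^ k
    have hS₂ : ∀ m : S₂, m.1 ∈ S ∧ f m ∈ IsLocalRing.maximalIdeal A ^ k := by
      intro m
      simpa [S₂] using m.2
    have h2 := length_quotient_add_card_le (Ideal.pow_le_pow_right k.le_succ)
      (fun m : S₂ => f m) (fun m => (hS₂ m).2) (J := IsLocalRing.maximalIdeal A ^ (k + 1)) (by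
      intro a ha m
      let b : M → A := fun m => if h : m ∈ S₂ then a ⟨m, h⟩ else 0
      have hb : ∀ m : S₂, b m = a m := fun m => by simp [b]
      have hsum : ∑ m ∈ S₂, b m * f m ∈ IsLocalRing.maximalIdeal A ^ (k + 1) := by
        rw [← Finset.sum_coe_sort]
        simpa only [hb] using ha
      have key := mem_of_sum_smul_mem (r := r) (IsLocalRing.maximalIdeal A ^ (k + 1)) S₂
        (fun m => b m * f m) (by
        intro t
        have h1 := act_mem_pow (r := r) hsum t
        rw [map_sum] at h1
        rw [← sub_sub_cancel (∑ m ∈ S₂, r.act t (b m * f m)) (∑ m ∈ S₂, r.chr m t • (b m * f m))]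
        refine sub_mem h1 ?_
        rw [← Finset.sum_sub_distrib]
        refine Ideal.sum_mem _ fun m hm => ?_
        -- As `act t (b m) - b m` is in m and `f m` in m^k, multiplying by `b m` does not change the
        -- weight modulo m^(k+1).
        have h3 : r.act t (b m * f m) - r.chr m t • (b m * f m) =
            r.act t (b m) * (r.act t (f m) - r.chr m t • f m) +
            r.chr m t • ((r.act t (b m) - b m) * f m) := by
          rw [map_mul, Algebra.smul_def, Algebra.smul_def, Algebra.smul_def]
          ring
        rw [h3]
        refine add_mem (Ideal.mul_mem_left _ _ (hf m (hS₂ ⟨m, hm⟩).1 t)) (Submodule.smul_of_tower_mem _ _ ?_)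
        rw [pow_succ']
        exact Ideal.mul_mem_mul (r.act_sub_mem t _) (hS₂ ⟨m, hm⟩).2) m.1 m.2
      by_contra hunit
      have hu : IsUnit (b m) := by
        rw [hb]
        simpa using hunit
      exact hfk m (hS₂ m).1 ((Ideal.unit_mul_mem_iff_mem _ hu).mp key))
    rw [← Finset.card_filter_add_card_filter_not (fun m => f m ∉ IsLocalRing.maximalIdeal A ^ k)]
    push_cast
    refine le_trans (add_le_add_left h1 _) (le_trans (le_of_eq ?_) h2)
    rw [Fintype.card_coe]

end WeightAction

/-! ### Visible weights and the bound on their rank -/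

namespace WeightAction

theorem pow_dvd_of_mem_pow {A V : Type*} [CommRing A] [IsLocalRing A] [CommRing V] {φ : A →+* V}
    {u : V} (hdvd : ∀ a ∈ IsLocalRing.maximalIdeal A, u ∣ φ a) {k : ℕ} {a : A}
    (ha : a ∈ IsLocalRing.maximalIdeal A ^ k) : u ^ k ∣ φ a := by
  have h : Ideal.map φ (IsLocalRing.maximalIdeal A) ≤ Ideal.span {u} := by
    rw [Ideal.map_le_iff_le_comap]
    exact fun a ha => Ideal.mem_span_singleton.mpr (hdvd a ha)
  have h2 := Ideal.pow_right_mono h k (Ideal.map_pow φ _ k ▸ Ideal.mem_map_of_mem φ ha)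
  rwa [Ideal.span_singleton_pow, Ideal.mem_span_singleton] at h2

variable {G M : Type*} {A : Type u} [Monoid G] [AddCommGroup M] [CommRing A] [IsLocalRing A]
  [Algebra ℂ A] {r : WeightAction G M A} {V : Type*} [CommRing V] {φ : A →+* V} {u : V}

variable (r φ u) in
/-- The weight `m` is visible in `V` if some weight vector of weight `m` modulo `k` maps to a
divisor of a power of `u` that is smaller than `k`. -/
def IsVisible (m : M) : Prop :=
  ∃ k l : ℕ, l < k ∧ ∃ f, r.IsWeight k m f ∧ φ f ∣ u ^ l

/-- What matters is that `l` does not depend on `k`. Lifting changes `φ f` by a multiple of `u ^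
k₀`; as `φ f` divides `u ^ l` with `l < k₀`, this multiplies it by `1 - u * _`, a unit of `V`. -/
theorem IsVisible.exists_isWeight [IsLocalRing V] (hu : ¬ IsUnit u)
    (hdvd : ∀ a ∈ IsLocalRing.maximalIdeal A, u ∣ φ a) {m : M} (h : r.IsVisible φ u m) :
    ∃ l : ℕ, ∀ k : ℕ, ∃ f, r.IsWeight k m f ∧ φ f ∣ u ^ l := by
  obtain ⟨k₀, l, hl, f, hf, hfu⟩ := h
  refine ⟨l, fun k => ?_⟩
  rcases le_total k k₀ with hk | hk
  · exact ⟨f, hf.mono hk, hfu⟩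
  · obtain ⟨g, hg, hfg⟩ := hf.exists_lift hk
    refine ⟨g, hg, ?_⟩
    obtain ⟨c, hc⟩ := pow_dvd_of_mem_pow hdvd hfg
    obtain ⟨e, he⟩ := hfu
    have h1 : φ g = φ f * (1 - u * (u ^ (k₀ - l - 1) * e * c)) := by
      have h2 : u ^ k₀ = u ^ l * u * u ^ (k₀ - l - 1) := by
        rw [← pow_succ, ← pow_add]
        congr 1
        omega
      rw [map_sub, h2, he] at hc
      linear_combination -hc
    have hunit : IsUnit (1 - u * (u ^ (k₀ - l - 1) * e * c)) :=
      IsLocalRing.isUnit_one_sub_self_of_mem_nonunits _ (fun h => hu (isUnit_of_mul_isUnit_left h))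
    rw [h1, hunit.mul_right_dvd]
    exact ⟨e, he⟩

/-- Monomials in the weight vectors produce more weights than the length of A/m^k allows, unless the
number of independent weights is at most the degree of growth. -/
theorem card_le_of_linearIndepOn [IsNoetherianRing A] [IsLocalRing V] [IsDomain V] (hu0 : u ≠ 0)
    (hu : ¬ IsUnit u) (hdvd : ∀ a ∈ IsLocalRing.maximalIdeal A, u ∣ φ a) (B : Finset M)
    (hB : ∀ m ∈ B, r.IsVisible φ u m) (hind : LinearIndepOn ℤ id (B : Set M)) :
    (B.card : WithBot ℕ∞) ≤ ringKrullDim A := by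
  classical
  obtain ⟨C, d, hd, hC⟩ := exists_length_quotient_maximalIdeal_pow_le (A := A)
  rw [← hd]
  choose! l hl using fun m hm => (hB m hm).exists_isWeight hu hdvd
  let Λ := ∑ m ∈ B, l m
  have key : ∀ K : ℕ, K ^ B.card ≤ C * (K * Λ + 1) ^ d := by
    intro K
    -- Monomials with exponents below `K` divide `u ^ (K * Λ)`, whereas elements of m^(KΛ+1) are
    -- divisible by one more power of `u`; so these monomials are nonzero modulo m^(KΛ+1).
    choose! f hf hfu using fun m hm => hl m hm (K * Λ + 1)
    let w : (B → Fin K) → M := fun x => ∑ m : B, (x m : ℕ) • (m : M)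
    have hw : Function.Injective w := by
      intro x y hxy
      have h1 : ∑ m : B, ((x m : ℤ) - (y m : ℤ)) • (m : M) = 0 := by
        simp only [sub_smul, Finset.sum_sub_distrib, natCast_zsmul]
        exact sub_eq_zero.mpr hxy
      have h2 := Fintype.linearIndependent_iff.mp hind (fun m => (x m : ℤ) - (y m : ℤ)) h1
      funext m
      have := h2 m
      exact Fin.ext (by omega)
    have hcard : (Finset.univ.image w).card = K ^ B.card := by
      rw [Finset.card_image_of_injective _ hw, Finset.card_univ]
      simp
    have h := card_le_length (r := r) (K * Λ + 1) (Finset.univ.image w) (by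
      intro m hm
      obtain ⟨x, _, rfl⟩ := Finset.mem_image.mp hm
      refine ⟨∏ m : B, f m ^ (x m : ℕ), ?_, fun hmem => ?_⟩
      · have hpow : ∀ (m : M) (g : A) (k n : ℕ), r.IsWeight k m g →
            r.IsWeight k (n • m) (g ^ n) := by
          intro m g k n hg
          induction n with
          | zero => simpa using IsWeight.one (r := r) k
          | succ n ih =>
            rw [succ_nsmul, pow_succ]
            exact ih.mul hg
        have hprod : ∀ T : Finset B, r.IsWeight (K * Λ + 1) (∑ m ∈ T, (x m : ℕ) • (m : M))
            (∏ m ∈ T, f m ^ (x m : ℕ)) := by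
          intro T
          induction T using Finset.induction_on with
          | empty => simpa using IsWeight.one (r := r) _
          | insert m T hm ih =>
            rw [Finset.sum_insert hm, Finset.prod_insert hm]
            exact (hpow _ _ _ _ (hf m m.2)).mul ih
        exact hprod Finset.univ
      · have h1 := pow_dvd_of_mem_pow hdvd hmem
        have h2 : φ (∏ m : B, f m ^ (x m : ℕ)) ∣ u ^ (K * Λ) := by
          have h3 : ∑ m : B, l m * (x m : ℕ) ≤ K * Λ := by
            change _ ≤ K * ∑ m ∈ B, l m
            rw [← Finset.sum_coe_sort B, Finset.mul_sum]
            refine Finset.sum_le_sum fun m _ => ?_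
            rw [mul_comm]
            exact Nat.mul_le_mul_right _ (x m).2.le
          refine dvd_trans ?_ (pow_dvd_pow u h3)
          rw [map_prod, ← Finset.prod_pow_eq_pow_sum]
          refine Finset.prod_dvd_prod_of_dvd _ _ fun m _ => ?_
          rw [map_pow, pow_mul]
          exact pow_dvd_pow_of_dvd (hfu m m.2) _
        have h4 := (pow_dvd_pow_iff hu0 hu).mp (h1.trans h2)
        omega)
    rw [hcard] at h
    exact_mod_cast h.trans (hC _)
  suffices B.card ≤ d by exact_mod_cast this
  by_contra! hlt
  -- If `B.card > d`, then K^(d+1) ≤ C (K(Λ+1))^d, that is K ≤ C (Λ+1)^d, which this `K` violates.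
  let K := C * (Λ + 1) ^ d + 1
  have h1 := key K
  have h2 : K ^ (d + 1) ≤ K ^ B.card := Nat.pow_le_pow_right (Nat.succ_pos _) hlt
  have h3 : (K * Λ + 1) ^ d ≤ (K * (Λ + 1)) ^ d := by
    refine Nat.pow_le_pow_left ?_ d
    have : 1 ≤ K := Nat.succ_pos _
    nlinarith
  have h4 : K ^ d * K ≤ K ^ d * (C * (Λ + 1) ^ d) := by
    calc K ^ d * K = K ^ (d + 1) := (pow_succ _ _).symm
      _ ≤ C * (K * Λ + 1) ^ d := h2.trans h1
      _ ≤ C * (K * (Λ + 1)) ^ d := Nat.mul_le_mul_left _ h3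
      _ = K ^ d * (C * (Λ + 1) ^ d) := by rw [mul_pow]; ring
  have h5 := Nat.le_of_mul_le_mul_left h4 (pow_pos (Nat.succ_pos _) d)
  exact absurd h5 (by simp [K])

variable (r) in
/-- For an action on a Noetherian local domain, there are at most `dim A` independent weights such
that all elements of the group on which they are trivial act trivially. -/
theorem exists_linearIndepOn_card_le [IsDomain A] [IsNoetherianRing A] [Module.Finite ℤ M] :
    ∃ B : Finset M, LinearIndepOn ℤ id (B : Set M) ∧ (B.card : WithBot ℕ∞) ≤ ringKrullDim A ∧
      ∀ t, (∀ (m : M) (a : ℤ), a ≠ 0 → a • m ∈ Submodule.span ℤ (B : Set M) → r.chr m t = 1) →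
        ∀ f, r.act t f = f := by
  obtain ⟨K, _, V, φ, u, hφ, hu0, hu, hdvd, hcof⟩ := exists_valuationSubring_dvd
    (IsLocalRing.maximalIdeal A) (IsLocalRing.maximalIdeal.isMaximal A).ne_top
  obtain ⟨s, hs, hmax⟩ := exists_maximal_linearIndepOn ℤ
    (Subtype.val : {m // r.IsVisible φ u m} → M)
  have hs' : LinearIndepOn ℤ id (Subtype.val '' s) := hs.id_image
  have hfin : (Subtype.val '' s : Set M).Finite := LinearIndependent.setFinite hs'
  refine ⟨hfin.toFinset, by simpa using hs', ?_, ?_⟩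
  · refine card_le_of_linearIndepOn (r := r) hu0 hu hdvd _ ?_ (by simpa using hs')
    intro m hm
    obtain ⟨m, _, rfl⟩ := hfin.mem_toFinset.mp hm
    exact m.2
  · intro t ht f
    rw [hfin.coe_toFinset] at ht
    have hvis : ∀ m, r.IsVisible φ u m → r.chr m t = 1 := by
      intro m hm
      by_cases hms : (⟨m, hm⟩ : {m // r.IsVisible φ u m}) ∈ s
      · refine ht m 1 one_ne_zero ?_
        rw [one_smul]
        exact Submodule.subset_span ⟨_, hms, rfl⟩
      · obtain ⟨a, ha, ham⟩ := hmax _ hms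
        exact ht m a ha ham
    have hdiv : ∀ k, u ^ k ∣ φ (r.act t f - f) := by
      intro k
      -- Order `k + 1` makes a weight vector dividing `u ^ k` visible. A component of invisible
      -- weight does not divide `u ^ k`, so it is a multiple of `u ^ k` in the valuation ring.
      obtain ⟨S, c, hc, hfc⟩ := r.exists_isWeight_expansion f (k + 1)
      have h1 : r.act t f - f - ∑ m ∈ S, (r.chr m t - 1) • c m ∈
          IsLocalRing.maximalIdeal A ^ (k + 1) := by
        have h2 := act_mem_pow (r := r) hfc t
        rw [map_sub, map_sum] at h2
        have h3 : ∑ m ∈ S, (r.act t (c m) - r.chr m t • c m) ∈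
            IsLocalRing.maximalIdeal A ^ (k + 1) := Ideal.sum_mem _ fun m hm => hc m hm t
        rw [Finset.sum_sub_distrib] at h3
        convert sub_mem (add_mem h2 h3) hfc using 1
        simp only [sub_smul, one_smul, Finset.sum_sub_distrib]
        abel
      have h4 := (pow_dvd_pow u k.le_succ).trans (pow_dvd_of_mem_pow hdvd h1)
      rw [map_sub] at h4
      refine (dvd_sub_left ?_).mp h4
      rw [map_sum]
      refine Finset.dvd_sum fun m hm => ?_
      by_cases hv : r.IsVisible φ u m
      · rw [hvis m hv, sub_self, zero_smul, map_zero]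
        exact dvd_zero _
      · have h5 : ¬ φ (c m) ∣ u ^ k := fun h => hv ⟨k + 1, k, k.lt_succ_self, c m, hc m hm, h⟩
        rw [Algebra.smul_def, map_mul]
        exact ((ValuationRing.dvd_total _ _).resolve_left h5).mul_left _
    by_contra hne
    have hne' : φ (r.act t f - f) ≠ 0 := by
      rw [Ne, map_eq_zero_iff φ hφ, sub_eq_zero]
      exact hne
    obtain ⟨l, hl⟩ := hcof _ hne'
    have := (pow_dvd_pow_iff hu0 hu).mp ((hdiv (l + 1)).trans hl)
    omega

end WeightAction

/-! ### Character lattices and dimensions of their group algebras -/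

/-- A finite independent set `B` in a free abelian group of rank `n` lies in the kernel of a
surjection onto a free abelian group of rank `n - #B`. -/
theorem exists_surjective_of_linearIndepOn {n : ℕ} (B : Finset (Fin n → ℤ))
    (hB : LinearIndepOn ℤ id (B : Set (Fin n → ℤ))) :
    ∃ (m : ℕ) (π : (Fin n → ℤ) →+ (Fin m → ℤ)), Function.Surjective π ∧ m + B.card = n ∧
      ∀ (x : Fin n → ℤ) (a : ℤ), a ≠ 0 → a • x ∈ Submodule.span ℤ (B : Set (Fin n → ℤ)) →
        π x = 0 := by
  let N := Submodule.span ℤ (B : Set (Fin n → ℤ))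
  -- Killing the torsion amounts to dividing by the saturation of `N`, which leaves a free quotient
  -- of the same rank.
  let T := Submodule.torsion ℤ ((Fin n → ℤ) ⧸ N)
  let b := Module.finBasis ℤ (((Fin n → ℤ) ⧸ N) ⧸ T)
  let π := (b.equivFun.toLinearMap.comp T.mkQ).comp N.mkQ
  refine ⟨_, π.toAddMonoidHom, ?_, ?_, ?_⟩
  · exact (b.equivFun.surjective.comp T.mkQ_surjective).comp N.mkQ_surjective
  · have h1 : Module.finrank ℤ N = B.card := finrank_span_finset_eq_card hB
    have h2 : Module.finrank ℤ (((Fin n → ℤ) ⧸ N) ⧸ T) = Module.finrank ℤ ((Fin n → ℤ) ⧸ N) :=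
      finrank_quotient_eq_of_le_torsion le_rfl
    have h3 := N.finrank_quotient_add_finrank
    rw [h2, ← h1, h3, Module.finrank_fin_fun]
  · intro x a ha hx
    have h1 : N.mkQ x ∈ T := by
      rw [Submodule.mem_torsion_iff]
      refine ⟨⟨a, mem_nonZeroDivisors_of_ne_zero ha⟩, ?_⟩
      change a • N.mkQ x = 0
      rw [← map_smul, Submodule.mkQ_apply, Submodule.Quotient.mk_eq_zero]
      exact hx
    have h2 : T.mkQ (N.mkQ x) = 0 := (Submodule.Quotient.mk_eq_zero _).mpr h1
    change b.equivFun (T.mkQ (N.mkQ x)) = 0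
    rw [h2, map_zero]

theorem ringKrullDim_le_of_isLocalization {R S : Type*} [CommRing R] [CommRing S] [Algebra R S]
    (P : Submonoid R) [IsLocalization P S] : ringKrullDim S ≤ ringKrullDim R := by
  rw [← PrimeSpectrum.topologicalKrullDim_eq_ringKrullDim,
    ← PrimeSpectrum.topologicalKrullDim_eq_ringKrullDim]
  exact (PrimeSpectrum.localization_comap_isEmbedding S P).isInducing.topologicalKrullDim_le

-- The ring is a localization of the polynomial ring; conversely, evaluation at 1 is onto `R` and
-- kills the nonzerodivisor `T - 1`.
open LaurentPolynomial in
theorem ringKrullDim_laurentPolynomial {R : Type*} [CommRing R] [IsNoetherianRing R] :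
    ringKrullDim R[T;T⁻¹] = ringKrullDim R + 1 := by
  apply le_antisymm
  · rw [← Polynomial.ringKrullDim_of_isNoetherianRing]
    exact ringKrullDim_le_of_isLocalization (Submonoid.powers (Polynomial.X : Polynomial R))
  · let f : R[T;T⁻¹] →+* R := eval₂ (RingHom.id R) 1
    refine ringKrullDim_succ_le_of_surjective f (fun x => ⟨C x, by simp [f]⟩)
      (r := Polynomial.toLaurent (Polynomial.X - Polynomial.C 1)) ?_ ?_
    · have h := (Polynomial.monic_X_sub_C (1 : R)).mem_nonZeroDivisors
      exact IsLocalization.map_nonZeroDivisors_le (Submonoid.powers (Polynomial.X : Polynomial R))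
        R[T;T⁻¹] ⟨_, h, rfl⟩
    · simp [f]

theorem isNoetherianRing_addMonoidAlgebra (n : ℕ) :
    IsNoetherianRing (AddMonoidAlgebra ℂ (Fin n → ℤ)) :=
  Algebra.FiniteType.isNoetherianRing ℂ _

theorem ringKrullDim_addMonoidAlgebra (n : ℕ) :
    ringKrullDim (AddMonoidAlgebra ℂ (Fin n → ℤ)) = n := by
  induction n with
  | zero =>
    rw [ringKrullDim_eq_of_ringEquiv (AddMonoidAlgebra.uniqueRingEquiv (R := ℂ) (Fin 0 → ℤ))]
    exact ringKrullDim_eq_zero_of_field ℂ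
  | succ n ih =>
    have := isNoetherianRing_addMonoidAlgebra n
    have e1 := (AddMonoidAlgebra.domCongr ℂ ℂ
      (Fin.consLinearEquiv ℤ (fun _ : Fin (n + 1) => ℤ)).symm.toAddEquiv).toRingEquiv
    have e2 := AddMonoidAlgebra.curryRingEquiv (R := ℂ) (M := ℤ) (N := Fin n → ℤ)
    rw [ringKrullDim_eq_of_ringEquiv (e1.trans e2), ringKrullDim_laurentPolynomial, ih]
    push_cast
    rfl

/-! ### Affine schemes over ℂ, points and translations -/

/-- The spectrum of a `ℂ`-algebra as a scheme over `ℂ`. -/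
noncomputable abbrev affine (R : Type) [CommRing R] [Algebra ℂ R] : SchC :=
  (Spec (CommRingCat.of R)).asOver (Spec (CommRingCat.of ℂ))

section Affine

variable {R R' R'' : Type} [CommRing R] [Algebra ℂ R] [CommRing R'] [Algebra ℂ R']
  [CommRing R''] [Algebra ℂ R'']

/-- The morphism of affine schemes over `ℂ` induced by an algebra homomorphism. -/
noncomputable def affineMap (f : R →ₐ[ℂ] R') : affine R' ⟶ affine R :=
  (Spec.map (CommRingCat.ofHom f.toRingHom)).asOver _

theorem affineMap_comp (f : R →ₐ[ℂ] R') (g : R' →ₐ[ℂ] R'') :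
    affineMap (g.comp f) = affineMap g ≫ affineMap f := by
  ext1
  exact Spec.map_comp (CommRingCat.ofHom f.toRingHom) (CommRingCat.ofHom g.toRingHom)

theorem affineMap_id : affineMap (AlgHom.id ℂ R) = 𝟙 (affine R) := by
  ext1
  exact Spec.map_id _

theorem affineMap_injective : Function.Injective (affineMap : (R →ₐ[ℂ] R') → _) := by
  intro f g h
  have h1 := Spec.map_injective (congrArg CommaMorphism.left h)
  exact AlgHom.ext fun x => congrArg (fun k => k.hom x) h1

theorem affineMap_surjective (f : affine R' ⟶ affine R) : ∃ g : R →ₐ[ℂ] R', affineMap g = f := by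
  have h : CommRingCat.ofHom (algebraMap ℂ R) ≫ Spec.preimage f.left =
      CommRingCat.ofHom (algebraMap ℂ R') := by
    apply Spec.map_injective
    refine (Spec.map_comp _ _).trans ?_
    exact (congrArg (· ≫ Spec.map (CommRingCat.ofHom (algebraMap ℂ R)))
      (Spec.map_preimage f.left)).trans (Over.w f)
  refine ⟨⟨(Spec.preimage f.left).hom, fun r => congrArg (fun k => k.hom r) h⟩, ?_⟩
  ext1
  exact Spec.map_preimage f.left

end Affine

theorem affine_complex_hom : (affine ℂ).hom = 𝟙 _ := Spec.map_id _

/-- The structure morphism of a scheme over `ℂ`, as a morphism to the point. -/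
noncomputable def toPoint (Y : SchC) : Y ⟶ affine ℂ :=
  Over.homMk Y.hom ((congrArg (Y.hom ≫ ·) affine_complex_hom).trans (Category.comp_id Y.hom))

theorem toPoint_unique {Y : SchC} (f g : Y ⟶ affine ℂ) : f = g := by
  have h : ∀ f : Y ⟶ affine ℂ, f.left = Y.hom := fun f =>
    (Category.comp_id f.left).symm.trans
      ((congrArg (f.left ≫ ·) affine_complex_hom.symm).trans (Over.w f))
  ext1
  rw [h f, h g]

section Translation

variable {T X : SchC} [GrpObj T] [ModObj T X]

/-- The automorphism of `X` given by the action of a point `t` of `T`. -/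
noncomputable def translation (X : SchC) [ModObj T X] (t : affine ℂ ⟶ T) : X ⟶ X :=
  (toPoint X ≫ t) • 𝟙 X

theorem comp_translation {Y : SchC} (y : Y ⟶ X) (t : affine ℂ ⟶ T) :
    y ≫ translation X t = (toPoint Y ≫ t) • y := by
  rw [translation, ModObj.comp_smul, ← Category.assoc, toPoint_unique (y ≫ toPoint X) (toPoint Y),
    Category.comp_id]

theorem translation_one : translation X (1 : affine ℂ ⟶ T) = 𝟙 X := by
  rw [translation, MonObj.comp_one, one_smul]

theorem translation_mul (t s : affine ℂ ⟶ T) :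
    translation X (t * s) = translation X s ≫ translation X t := by
  rw [comp_translation, translation, translation, MonObj.comp_mul, mul_smul]

end Translation

/-- A morphism from an affine scheme all of whose points map to generizations of `x` factors through
the spectrum of the local ring at `x`. -/
theorem exists_comp_fromSpecStalk {X : Scheme} (x : X) {R : CommRingCat} (ψ : Spec R ⟶ X)
    (h : ∀ p, ψ p ⤳ x) : ∃ f : X.presheaf.stalk x ⟶ R, Spec.map f ≫ X.fromSpecStalk x = ψ := by
  obtain ⟨U, hU, hxU, -⟩ := exists_isAffineOpen_mem_and_subset (x := x) (U := ⊤) trivial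
  have hrange : Set.range ψ ⊆ Set.range U.ι := by
    rintro _ ⟨p, rfl⟩
    rw [Scheme.Opens.range_ι]
    exact (h p).mem_open U.2 hxU
  let ψ' : Spec R ⟶ U := IsOpenImmersion.lift U.ι ψ hrange
  have hψ' : ψ' ≫ U.ι = ψ := IsOpenImmersion.lift_fac _ _ _
  let g : Γ(X, U) ⟶ R := Spec.preimage (ψ' ≫ hU.isoSpec.hom)
  have hg : Spec.map g ≫ hU.fromSpec = ψ := by
    rw [Spec.map_preimage, ← hU.isoSpec_inv_ι, Category.assoc, Iso.hom_inv_id_assoc, hψ']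
  let q : Spec Γ(X, U) := hU.primeIdealOf ⟨x, hxU⟩
  have hq : hU.fromSpec q = x := hU.fromSpec_primeIdealOf ⟨x, hxU⟩
  -- A prime containing `g s` would map to a generization of `x`, so its preimage would lie in `q`,
  -- which does not contain `s`.
  have hunit : ∀ s : q.asIdeal.primeCompl, IsUnit (g.hom s) := by
    intro s
    by_contra hs
    obtain ⟨P, hP, hsP⟩ := exists_max_ideal_of_mem_nonunits hs
    let p : Spec R := ⟨P, hP.isPrime⟩
    have h1 : hU.fromSpec (Spec.map g p) = ψ p := by
      rw [← Scheme.Hom.comp_apply, hg]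
    have h2 : Spec.map g p ⤳ q := by
      rw [← hU.fromSpec.isOpenEmbedding.isInducing.specializes_iff, h1, hq]
      exact h p
    have h3 := (PrimeSpectrum.le_iff_specializes _ _).mpr h2
    exact s.2 (h3 hsP)
  let := X.presheaf.algebra_section_stalk ⟨x, hxU⟩
  have hloc : IsLocalization.AtPrime (X.presheaf.stalk x) q.asIdeal :=
    hU.isLocalization_stalk ⟨x, hxU⟩
  let k : X.presheaf.stalk x →+* R := IsLocalization.lift (M := q.asIdeal.primeCompl) hunit
  have hk : X.presheaf.germ U x hxU ≫ CommRingCat.ofHom (R := X.presheaf.stalk x) k = g := by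
    ext a
    exact IsLocalization.lift_eq hunit a
  refine ⟨CommRingCat.ofHom k, ?_⟩
  rw [← hU.fromSpecStalk_eq_fromSpecStalk hxU, IsAffineOpen.fromSpecStalk]
  refine (Spec.map_comp_assoc _ _ _).symm.trans ?_
  refine (congrArg (fun m => Spec.map m ≫ hU.fromSpec) hk).trans hg

/-! ### Tori in coordinates and their characters -/

/-- The group algebra of `ℤ ^ n` over `ℂ`. -/
abbrev Lattice (n : ℕ) : Type := AddMonoidAlgebra ℂ (Fin n → ℤ)

section AlgHomOf

variable {R R' : Type} [CommRing R] [Algebra ℂ R] [CommRing R'] [Algebra ℂ R']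

/-- The algebra homomorphism underlying a morphism of affine schemes over `ℂ`. -/
noncomputable def algHomOf (f : affine R' ⟶ affine R) : R →ₐ[ℂ] R' :=
  (affineMap_surjective f).choose

@[simp]
theorem affineMap_algHomOf (f : affine R' ⟶ affine R) : affineMap (algHomOf f) = f :=
  (affineMap_surjective f).choose_spec

@[simp]
theorem algHomOf_affineMap (f : R →ₐ[ℂ] R') : algHomOf (affineMap f) = f :=
  affineMap_injective (affineMap_algHomOf _)

theorem algHomOf_comp {R'' : Type} [CommRing R''] [Algebra ℂ R''] (f : affine R' ⟶ affine R)
    (g : affine R'' ⟶ affine R') : algHomOf (g ≫ f) = (algHomOf g).comp (algHomOf f) := by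
  apply affineMap_injective
  rw [affineMap_comp, affineMap_algHomOf, affineMap_algHomOf, affineMap_algHomOf]

end AlgHomOf

section Lattice

variable {n : ℕ}

/-- The inclusion of the Laurent polynomials in the `i`-th variable. -/
noncomputable def coordinate (i : Fin n) : LaurentPolynomial ℂ →ₐ[ℂ] Lattice n :=
  AddMonoidAlgebra.mapDomainAlgHom ℂ ℂ (AddMonoidHom.single (fun _ : Fin n => ℤ) i)

theorem coordinate_single (i : Fin n) (k : ℤ) (c : ℂ) :
    coordinate i (AddMonoidAlgebra.single k c) = AddMonoidAlgebra.single (Pi.single i k) c := by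
  simp only [coordinate, AddMonoidAlgebra.mapDomainAlgHom_apply, AddMonoidAlgebra.mapDomain_single]
  rfl

theorem groupAlgebra_hom_ext {L B : Type} [AddMonoid L] [CommRing B] [Algebra ℂ B]
    {f g : AddMonoidAlgebra ℂ L →ₐ[ℂ] B}
    (h : ∀ m, f (AddMonoidAlgebra.single m 1) = g (AddMonoidAlgebra.single m 1)) : f = g :=
  AddMonoidAlgebra.algHom_ext h (Subsingleton.elim _ _)

theorem lattice_hom_ext_single {B : Type} [CommRing B] [Algebra ℂ B] {f g : Lattice n →ₐ[ℂ] B}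
    (h : ∀ i, f (AddMonoidAlgebra.single (Pi.single i 1) 1) =
      g (AddMonoidAlgebra.single (Pi.single i 1) 1)) : f = g := by
  let F : (Lattice n →ₐ[ℂ] B) → (Fin n → ℤ) →+ Additive B := fun f =>
    { toFun := fun m => Additive.ofMul (f (AddMonoidAlgebra.single m 1))
      map_zero' := congrArg Additive.ofMul (map_one f)
      map_add' := fun m m' => congrArg Additive.ofMul (show f _ = f _ * f _ by
        rw [← map_mul, AddMonoidAlgebra.single_mul_single, one_mul]) }
  have h2 : F f = F g := by
    refine AddMonoidHom.functions_ext _ _ _ fun i k => ?_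
    have h3 : (F f).comp (AddMonoidHom.single (fun _ : Fin n => ℤ) i) =
        (F g).comp (AddMonoidHom.single (fun _ : Fin n => ℤ) i) := AddMonoidHom.ext_int (h i)
    exact DFunLike.congr_fun h3 k
  exact groupAlgebra_hom_ext fun m => congrArg Additive.toMul (DFunLike.congr_fun h2 m)

theorem lattice_hom_ext {B : Type} [CommRing B] [Algebra ℂ B] {f g : Lattice n →ₐ[ℂ] B}
    (h : ∀ i, f.comp (coordinate i) = g.comp (coordinate i)) : f = g := by
  refine lattice_hom_ext_single fun i => ?_
  rw [← coordinate_single]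
  exact DFunLike.congr_fun (h i) _

theorem exists_lattice_hom {B : Type} [CommRing B] [Algebra ℂ B]
    (g : Fin n → (LaurentPolynomial ℂ →ₐ[ℂ] B)) :
    ∃ f : Lattice n →ₐ[ℂ] B, ∀ i, f.comp (coordinate i) = g i := by
  let F : Multiplicative (Fin n → ℤ) →* B :=
    { toFun := fun m => ∏ i, g i (LaurentPolynomial.T (m.toAdd i))
      map_one' := by simp
      map_mul' := fun m m' => by
        rw [← Finset.prod_mul_distrib]
        refine Finset.prod_congr rfl fun i _ => ?_
        rw [← map_mul, ← LaurentPolynomial.T_add]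
        rfl }
  refine ⟨AddMonoidAlgebra.lift ℂ B _ F, fun i => ?_⟩
  refine groupAlgebra_hom_ext fun k => ?_
  rw [AlgHom.comp_apply, coordinate_single, AddMonoidAlgebra.lift_single, one_smul]
  change ∏ j, g j (LaurentPolynomial.T ((Pi.single i k : Fin n → ℤ) j)) = _
  rw [Finset.prod_eq_single i]
  · rw [Pi.single_eq_same]
    rfl
  · intro j _ hj
    rw [Pi.single_eq_of_ne hj, LaurentPolynomial.T_zero, map_one]
  · simp

open Limits in
/-- The spectrum of the group algebra of `ℤ ^ n` is the `n`-th power of `𝔾ₘ`. -/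
theorem nonempty_isLimit_lattice (n : ℕ) : Nonempty (IsLimit
    (Fan.mk (affine (Lattice n)) fun i => (affineMap (coordinate i) : _ ⟶ Gm))) := by
  let c : Cofan fun _ : Fin n => (CommAlgCat.of (CommRingCat.of ℂ) (LaurentPolynomial ℂ)) :=
    Cofan.mk (CommAlgCat.of (CommRingCat.of ℂ) (Lattice n)) fun i => CommAlgCat.ofHom (coordinate i)
  have hc : IsColimit c := by
    refine Cofan.IsColimit.mk c (fun s => CommAlgCat.ofHom
      (exists_lattice_hom fun i => (s.inj i).hom).choose) ?_ ?_
    · intro s i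
      exact CommAlgCat.hom_ext ((exists_lattice_hom fun i => (s.inj i).hom).choose_spec i)
    · intro s m hm
      refine CommAlgCat.hom_ext (lattice_hom_ext fun i => ?_)
      refine Eq.trans ?_ ((exists_lattice_hom fun i => (s.inj i).hom).choose_spec i).symm
      exact congrArg CommAlgCat.Hom.hom (hm i)
  have : PreservesLimitsOfSize.{0, 0} (algSpec (CommRingCat.of ℂ)) := preservesLimitsOfSize_algSpec
  have : PreservesLimitsOfShape (Discrete (Fin n)) (algSpec (CommRingCat.of ℂ)) := inferInstance
  exact ⟨isLimitFanMkObjOfIsLimit (algSpec (CommRingCat.of ℂ)) _ _ (Cofan.IsColimit.op hc)⟩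

end Lattice

/-- Points multiply by convolution, and `T 1` is group-like. -/
theorem algHomOf_mul_apply_T (a b : affine ℂ ⟶ Gm) :
    algHomOf (a * b) (LaurentPolynomial.T 1) =
      algHomOf a (LaurentPolynomial.T 1) * algHomOf b (LaurentPolynomial.T 1) := by
  have h : a * b = affineMap
      (WithConv.toConv (algHomOf a) * WithConv.toConv (algHomOf b)).ofConv := by
    refine Eq.trans ?_ (map_mul (Spec.mapMulEquiv (R := ℂ) (S := LaurentPolynomial ℂ) (T := ℂ))
      (WithConv.toConv (algHomOf a)) (WithConv.toConv (algHomOf b))).symm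
    exact congrArg₂ (· * ·) (affineMap_algHomOf a).symm (affineMap_algHomOf b).symm
  rw [h, algHomOf_affineMap, AlgHom.convMul_def]
  simp

/-- The group law is remembered only through the coordinates being homomorphisms; this is enough for
characters to be multiplicative on points. -/
theorem IsTorus.exists_iso {T : SchC} [GrpObj T] (hT : IsTorus T) :
    ∃ (n : ℕ) (e : T ≅ affine (Lattice n)),
      ∀ i, IsMonHom (e.hom ≫ affineMap (coordinate i) : T ⟶ Gm) := by
  obtain ⟨n, p, hp, ⟨hlim⟩⟩ := hT
  obtain ⟨hlim'⟩ := nonempty_isLimit_lattice n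
  refine ⟨n, hlim.conePointUniqueUpToIso hlim', fun i => ?_⟩
  have : (hlim.conePointUniqueUpToIso hlim').hom ≫ affineMap (coordinate i) = p i :=
    hlim.conePointUniqueUpToIso_hom_comp hlim' ⟨i⟩
  rw [this]
  exact hp i

section Points

variable {T : SchC} {n : ℕ} (e : T ≅ affine (Lattice n))

/-- The value of the character `m` at a point of a torus. -/
noncomputable def charValue (m : Fin n → ℤ) (t : affine ℂ ⟶ T) : ℂ :=
  algHomOf (t ≫ e.hom) (AddMonoidAlgebra.single m 1)

theorem charValue_zero (t : affine ℂ ⟶ T) : charValue e 0 t = 1 :=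
  map_one (algHomOf (t ≫ e.hom))

theorem charValue_add (m m' : Fin n → ℤ) (t : affine ℂ ⟶ T) :
    charValue e (m + m') t = charValue e m t * charValue e m' t := by
  rw [charValue, charValue, charValue, ← map_mul, AddMonoidAlgebra.single_mul_single, one_mul]

theorem charValue_ne_zero (m : Fin n → ℤ) (t : affine ℂ ⟶ T) : charValue e m t ≠ 0 := by
  intro h
  have h1 := charValue_add e m (-m) t
  rw [add_neg_cancel, charValue_zero, h, zero_mul] at h1
  exact one_ne_zero h1

variable {e} [GrpObj T]

theorem charValue_mul (he : ∀ i, IsMonHom (e.hom ≫ affineMap (coordinate i) : T ⟶ Gm))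
    (m : Fin n → ℤ) (t s : affine ℂ ⟶ T) :
    charValue e m (t * s) = charValue e m t * charValue e m s := by
  let F : Multiplicative (Fin n → ℤ) →* ℂ :=
    { toFun := fun m => charValue e m.toAdd t * charValue e m.toAdd s
      map_one' := by
        rw [toAdd_one, charValue_zero, charValue_zero, one_mul]
      map_mul' := fun m m' => by
        rw [toAdd_mul, charValue_add, charValue_add]
        ring }
  have h : algHomOf ((t * s) ≫ e.hom) = AddMonoidAlgebra.lift ℂ ℂ _ F := by
    refine lattice_hom_ext_single fun i => ?_
    rw [AddMonoidAlgebra.lift_single, one_smul, ← coordinate_single]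
    have key : ∀ t : affine ℂ ⟶ T, algHomOf (t ≫ e.hom) (coordinate i (LaurentPolynomial.T 1)) =
        algHomOf (t ≫ (e.hom ≫ affineMap (coordinate i) : T ⟶ Gm)) (LaurentPolynomial.T 1) := by
      intro t
      have h1 := algHomOf_comp (affineMap (coordinate i)) (t ≫ e.hom)
      rw [Category.assoc, algHomOf_affineMap] at h1
      exact (DFunLike.congr_fun h1 _).symm
    refine (key (t * s)).trans ?_
    have := he i
    rw [MonObj.mul_comp, algHomOf_mul_apply_T, ← key, ← key, LaurentPolynomial.T, coordinate_single]
    rfl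
  rw [charValue, h, AddMonoidAlgebra.lift_single, one_smul]
  rfl

theorem charValue_one (he : ∀ i, IsMonHom (e.hom ≫ affineMap (coordinate i) : T ⟶ Gm))
    (m : Fin n → ℤ) : charValue e m (1 : affine ℂ ⟶ T) = 1 := by
  have h := charValue_mul he m 1 1
  rw [one_mul] at h
  exact (mul_eq_left₀ (charValue_ne_zero e m 1)).mp h.symm

/-- The character `m` of a torus, on points. -/
noncomputable def charHom (he : ∀ i, IsMonHom (e.hom ≫ affineMap (coordinate i) : T ⟶ Gm))
    (m : Fin n → ℤ) : (affine ℂ ⟶ T) →* ℂ where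
  toFun := charValue e m
  map_one' := charValue_one he m
  map_mul' := charValue_mul he m

theorem charHom_injective (he : ∀ i, IsMonHom (e.hom ≫ affineMap (coordinate i) : T ⟶ Gm)) :
    Function.Injective (charHom he) := by
  intro m m' h
  funext i
  -- The point with `i`-th coordinate 2 and all others 1. Since 2 is not a root of unity, it detects
  -- `m i`.
  let F : Multiplicative (Fin n → ℤ) →* ℂ :=
    { toFun := fun m => (2 : ℂ) ^ (m.toAdd i)
      map_one' := by simp
      map_mul' := fun m m' => by
        rw [toAdd_mul, Pi.add_apply, zpow_add₀ two_ne_zero] }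
  let f : Lattice n →ₐ[ℂ] ℂ := AddMonoidAlgebra.lift ℂ ℂ _ F
  have hf : ∀ m, charHom he m (affineMap f ≫ e.inv) = (2 : ℂ) ^ (m i) := by
    intro m
    change charValue e m _ = _
    rw [charValue, Category.assoc, e.inv_hom_id, Category.comp_id, algHomOf_affineMap,
      AddMonoidAlgebra.lift_single, one_smul]
    rfl
  have h1 := DFunLike.congr_fun h (affineMap f ≫ e.inv)
  rw [hf, hf] at h1
  have h2 : (2 : ℝ) ^ (m i) = (2 : ℝ) ^ (m' i) := by
    apply Complex.ofReal_injective
    push_cast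
    exact h1
  exact zpow_right_injective₀ two_pos (by norm_num) h2

end Points

/-! ### The fixed locus on points -/

section FixedLocus

variable {T X : SchC} [GrpObj T] [ModObj T X]

theorem comp_translation_eq_of_isInvariant {I : X.left.IdealSheafData} (hI : IsInvariant T X I)
    (t : affine ℂ ⟶ T) : closedInclusion I ≫ translation X t = closedInclusion I := by
  obtain ⟨β, hβ, rfl⟩ := hI
  have h : closedInclusion I ≫ translation X t =
      lift (toPoint _ ≫ t) (𝟙 _) ≫ T ◁ closedInclusion I ≫ (γ[T, X] : T ⊗ X ⟶ X) := by
    rw [comp_translation, ← Category.assoc, lift_whiskerLeft, Category.id_comp]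
    rfl
  rw [h, ← hβ, lift_snd_assoc, Category.id_comp]

/-- Points of a torus fix the fixed point locus. -/
theorem subschemeι_comp_translation (hX : IsSeparated X.hom) (t : affine ℂ ⟶ T) :
    (sInf {I : X.left.IdealSheafData | IsInvariant T X I}).subschemeι ≫ (translation X t).left =
      (sInf {I : X.left.IdealSheafData | IsInvariant T X I}).subschemeι := by
  -- As `X` is separated, the equalizer is a closed subscheme. It contains every invariant closed
  -- subscheme, hence also the one cut out by the infimum of their ideals.
  let k := Limits.equalizer.ι (translation X t) (𝟙 X)
  have hk : k.left.ker ≤ sInf {I : X.left.IdealSheafData | IsInvariant T X I} := by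
    refine le_sInf fun I hI => ?_
    let l := Limits.equalizer.lift (f := translation X t) (g := 𝟙 X) (closedInclusion I) (by
        rw [comp_translation_eq_of_isInvariant hI, Category.comp_id])
    have h : l ≫ k = closedInclusion I := Limits.equalizer.lift_ι _ _
    refine (Scheme.Hom.le_ker_comp l.left k.left).trans ?_
    exact (congrArg Scheme.Hom.ker (congrArg CommaMorphism.left h)).le.trans
      (Scheme.IdealSheafData.ker_subschemeι I).le
  rw [← Scheme.IdealSheafData.ker_subschemeι (sInf _)] at hk
  have hfac := IsClosedImmersion.lift_fac k.left _ hk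
  have h2 : k.left ≫ (translation X t).left = k.left := by
    have h3 := Limits.equalizer.condition (translation X t) (𝟙 X)
    rw [Category.comp_id] at h3
    exact congrArg CommaMorphism.left h3
  rw [← hfac, Category.assoc, h2]

/-- A point of `X` is fixed by the points of `T`, together with its residue field. -/
def IsFixedPoint (T : SchC) [GrpObj T] {X : SchC} [ModObj T X] (x : X.left) : Prop :=
  ∀ t : affine ℂ ⟶ T, X.left.fromSpecResidueField x ≫ (translation X t).left =
    X.left.fromSpecResidueField x

theorem isFixedPoint_subschemeι (hX : IsSeparated X.hom)
    (y : (sInf {I : X.left.IdealSheafData | IsInvariant T X I}).subscheme) :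
    IsFixedPoint T ((sInf {I : X.left.IdealSheafData | IsInvariant T X I}).subschemeι y) := by
  intro t
  have h := subschemeι_comp_translation hX t
  generalize sInf {I : X.left.IdealSheafData | IsInvariant T X I} = I at *
  have : Surjective (Spec.map (I.subschemeι.residueFieldMap y)) :=
    ⟨fun p => ⟨IsLocalRing.closedPoint _, Subsingleton.elim _ _⟩⟩
  have : Epi (Spec.map (I.subschemeι.residueFieldMap y)) := Flat.epi_of_flat_of_surjective _
  rw [← cancel_epi (Spec.map (I.subschemeι.residueFieldMap y)), ← Category.assoc,
    Scheme.Hom.SpecMap_residueFieldMap_fromSpecResidueField, Category.assoc, h]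

end FixedLocus

/-! ### Orbit maps and evaluation at points of the torus -/

/-- Morphisms from an affine scheme to a separated scheme agree if they agree on a jointly injective
family of homomorphisms of algebras. -/
theorem hom_ext_of_jointly_injective {X : SchC} (hX : IsSeparated X.hom) {R S : Type} [CommRing R]
    [Algebra ℂ R] [CommRing S] [Algebra ℂ S] {J : Type*} (f : J → R →ₐ[ℂ] S)
    (hf : ∀ r, (∀ i, f i r = 0) → r = 0) {g h : affine R ⟶ X}
    (hgh : ∀ i, affineMap (f i) ≫ g = affineMap (f i) ≫ h) : g = h := by
  let k := Limits.equalizer.ι g h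
  let k' : (Limits.equalizer g h).left ⟶ Spec (CommRingCat.of R) := k.left
  have hk' : IsClosedImmersion k' := isClosedImmersion_equalizer_ι_left g h
  obtain ⟨I, e, he⟩ := IsClosedImmersion.Spec_iff.mp hk'
  -- The equalizer is the spectrum of `R ⧸ I`, and every `f i` factors through it, so `I` lies in
  -- all their kernels.
  have hI : I = ⊥ := by
    rw [eq_bot_iff]
    intro r hr
    refine hf r fun i => ?_
    have h1 : (Limits.equalizer.lift (affineMap (f i)) (hgh i) ≫ k) = affineMap (f i) :=
      Limits.equalizer.lift_ι _ _
    let l : Spec (CommRingCat.of S) ⟶ Spec (CommRingCat.of (R ⧸ I)) :=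
      (Limits.equalizer.lift (affineMap (f i)) (hgh i)).left ≫ e.hom
    have h2 : l ≫ Spec.map (CommRingCat.ofHom (Ideal.Quotient.mk I)) =
        Spec.map (CommRingCat.ofHom (f i).toRingHom) := by
      refine (Category.assoc _ e.hom _).trans ?_
      refine (congrArg ((Limits.equalizer.lift (affineMap (f i)) (hgh i)).left ≫ ·) he.symm).trans ?_
      exact congrArg CommaMorphism.left h1
    rw [← Spec.map_preimage l, ← Spec.map_comp] at h2
    have h3 := Spec.map_injective h2
    have h4 := congrArg (fun k => k.hom r) h3
    have h5 : Ideal.Quotient.mk I r = 0 := Ideal.Quotient.eq_zero_iff_mem.mpr hr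
    refine h4.symm.trans ?_
    change (Spec.preimage l).hom (Ideal.Quotient.mk I r) = 0
    rw [h5, map_zero]
  have h6 : Function.Injective (Ideal.Quotient.mk I) := by
    rw [RingHom.injective_iff_ker_eq_bot, Ideal.mk_ker, hI]
  have h7 : IsIso (CommRingCat.ofHom (Ideal.Quotient.mk I)) := by
    rw [ConcreteCategory.isIso_iff_bijective]
    exact ⟨h6, Ideal.Quotient.mk_surjective⟩
  have h8 : IsIso k' := by
    rw [he]
    infer_instance
  have h9 : IsIso k.left := h8
  have h10 : k.left ≫ g.left = k.left ≫ h.left :=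
    congrArg CommaMorphism.left (Limits.equalizer.condition g h)
  ext1
  rwa [cancel_epi] at h10

section Orbit

variable {T X : SchC} {n : ℕ} (e : T ≅ affine (Lattice n))
  (R : Type) [CommRing R] [Algebra ℂ R] {S : Type} [CommRing S] [Algebra ℂ S]

/-- The projection `T × Spec R ⟶ T`, in coordinates. -/
noncomputable def groupMap : affine (AddMonoidAlgebra R (Fin n → ℤ)) ⟶ T :=
  affineMap (AddMonoidAlgebra.mapAlgHom (Fin n → ℤ) (Algebra.ofId ℂ R)) ≫ e.inv

/-- Evaluation at a point of the torus. -/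
noncomputable def evalAt (t : affine ℂ ⟶ T) : AddMonoidAlgebra R (Fin n → ℤ) →ₐ[ℂ] R :=
  (AddMonoidAlgebra.lift R R (Fin n → ℤ)
    { toFun := fun m => algebraMap ℂ R (charValue e m.toAdd t)
      map_one' := by rw [toAdd_one, charValue_zero, map_one]
      map_mul' := fun m m' => by rw [toAdd_mul, charValue_add, map_mul] }).restrictScalars ℂ

variable {R}

theorem evalAt_apply (t : affine ℂ ⟶ T) (f : AddMonoidAlgebra R (Fin n → ℤ)) :
    evalAt e R t f = f.coeff.sum fun m a => charValue e m t • a := by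
  refine (AddMonoidAlgebra.lift_apply _ _).trans ?_
  refine Finsupp.sum_congr fun m _ => ?_
  exact (mul_comm _ _).trans (Algebra.smul_def _ _).symm

theorem evalAt_single (t : affine ℂ ⟶ T) (m : Fin n → ℤ) (a : R) :
    evalAt e R t (AddMonoidAlgebra.single m a) = charValue e m t • a := by
  rw [evalAt_apply]
  exact Finsupp.sum_single_index (smul_zero _)

theorem affineMap_evalAt_comp_groupMap (t : affine ℂ ⟶ T) :
    affineMap (evalAt e R t) ≫ groupMap e R = toPoint _ ≫ t := by
  have h : (evalAt e R t).comp (AddMonoidAlgebra.mapAlgHom (Fin n → ℤ) (Algebra.ofId ℂ R)) =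
      (Algebra.ofId ℂ R).comp (algHomOf (t ≫ e.hom)) := by
    refine groupAlgebra_hom_ext fun m => ?_
    have h1 : AddMonoidAlgebra.mapAlgHom (Fin n → ℤ) (Algebra.ofId ℂ R)
        (AddMonoidAlgebra.single m 1) = AddMonoidAlgebra.single m 1 := by simp
    refine (congrArg (evalAt e R t) h1).trans ((evalAt_single e t m _).trans ?_)
    rw [Algebra.smul_def, mul_one]
    rfl
  rw [groupMap, ← Category.assoc, ← affineMap_comp, h, affineMap_comp, affineMap_algHomOf,
    Category.assoc, Category.assoc, e.hom_inv_id, Category.comp_id,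
    toPoint_unique (toPoint _) (affineMap (Algebra.ofId ℂ R))]

theorem affineMap_mapAlgHom_comp_groupMap (f : R →ₐ[ℂ] S) :
    affineMap (AddMonoidAlgebra.mapAlgHom (Fin n → ℤ) f) ≫ groupMap e R = groupMap e S := by
  rw [groupMap, groupMap, ← Category.assoc, ← affineMap_comp]
  congr 2
  refine groupAlgebra_hom_ext fun m => ?_
  simp

theorem affineMap_evalAt_comp_singleZero (t : affine ℂ ⟶ T) :
    affineMap (evalAt e R t) ≫ affineMap AddMonoidAlgebra.singleZeroAlgHom = 𝟙 _ := by
  rw [← affineMap_comp, ← affineMap_id]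
  congr 1
  ext a
  refine (evalAt_single e t 0 a).trans ?_
  rw [charValue_zero, one_smul]
  rfl

variable [GrpObj T] [ModObj T X]

/-- The morphism `T × Spec R ⟶ X` obtained from a morphism `q : Spec R ⟶ X` by the action. -/
noncomputable def orbitMap (q : affine R ⟶ X) : affine (AddMonoidAlgebra R (Fin n → ℤ)) ⟶ X :=
  groupMap e R • (affineMap AddMonoidAlgebra.singleZeroAlgHom ≫ q)

theorem affineMap_evalAt_comp_orbitMap (q : affine R ⟶ X) (t : affine ℂ ⟶ T) :
    affineMap (evalAt e R t) ≫ orbitMap e q = q ≫ translation X t := by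
  rw [orbitMap, ModObj.comp_smul, affineMap_evalAt_comp_groupMap, ← Category.assoc,
    affineMap_evalAt_comp_singleZero, Category.id_comp, comp_translation]

theorem affineMap_mapAlgHom_comp_orbitMap (q : affine R ⟶ X) (f : R →ₐ[ℂ] S) :
    affineMap (AddMonoidAlgebra.mapAlgHom (Fin n → ℤ) f) ≫ orbitMap e q =
      orbitMap e (affineMap f ≫ q) := by
  rw [orbitMap, ModObj.comp_smul, affineMap_mapAlgHom_comp_groupMap, orbitMap, ← Category.assoc,
    ← Category.assoc, ← affineMap_comp, ← affineMap_comp]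
  congr 3
  ext a
  simp

variable {e}

/-- Independence of characters again, now with values in `K`. -/
theorem evalAt_injective (he : ∀ i, IsMonHom (e.hom ≫ affineMap (coordinate i) : T ⟶ Gm))
    {K : Type} [Field K] [Algebra ℂ K] (f : AddMonoidAlgebra K (Fin n → ℤ))
    (h : ∀ t, evalAt e K t f = 0) : f = 0 := by
  have h1 := (linearIndependent_monoidHom (affine ℂ ⟶ T) K).comp
    (fun m : Fin n → ℤ => ((algebraMap ℂ K : ℂ →* K).comp (charHom he m))) (by
      intro m m' hm
      apply charHom_injective he
      ext t
      exact (algebraMap ℂ K).injective (DFunLike.congr_fun hm t))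
  have h2 : f.coeff = 0 := by
    refine linearIndependent_iff.mp h1 f.coeff ?_
    funext t
    rw [Finsupp.linearCombination_apply, Finsupp.sum_apply', Pi.zero_apply]
    refine Eq.trans ?_ (h t)
    rw [evalAt_apply]
    refine Finsupp.sum_congr fun m _ => ?_
    exact (mul_comm (f.coeff m) _).trans (Algebra.smul_def _ _).symm
  ext m
  rw [h2]
  rfl

/-- Invariance under the ℂ-points of `T` is upgraded to invariance under the scheme `T`. -/
theorem orbitMap_eq (he : ∀ i, IsMonHom (e.hom ≫ affineMap (coordinate i) : T ⟶ Gm))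
    (hX : IsSeparated X.hom) {K : Type} [Field K] [Algebra ℂ K] (q : affine K ⟶ X)
    (hq : ∀ t : affine ℂ ⟶ T, q ≫ translation X t = q) :
    orbitMap e q = affineMap AddMonoidAlgebra.singleZeroAlgHom ≫ q := by
  refine hom_ext_of_jointly_injective hX (evalAt e K) (evalAt_injective he) fun t => ?_
  rw [affineMap_evalAt_comp_orbitMap, hq, ← Category.assoc, affineMap_evalAt_comp_singleZero,
    Category.id_comp]

end Orbit

/-! ### The action on the local ring of a fixed point -/

/-- A presentation of the local scheme of `X` at `x` as the spectrum of a local `ℂ`-algebra. -/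
structure LocalChart (X : SchC) (x : X.left) (A : Type) [CommRing A] [IsLocalRing A]
    [Algebra ℂ A] where
  hom : affine A ⟶ X
  mono : Mono hom
  specializes : ∀ p, hom.left p ⤳ x
  apply_closedPoint : hom.left (IsLocalRing.closedPoint A) = x
  exists_lift : ∀ {R : Type} [CommRing R] [Algebra ℂ R] (ψ : affine R ⟶ X),
    (∀ p, ψ.left p ⤳ x) → ∃ f : A →ₐ[ℂ] R, affineMap f ≫ hom = ψ

/-- The residue map of a local algebra. -/
noncomputable def residueHom (A : Type) [CommRing A] [IsLocalRing A] [Algebra ℂ A] :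
    A →ₐ[ℂ] IsLocalRing.ResidueField A :=
  IsScalarTower.toAlgHom ℂ A (IsLocalRing.ResidueField A)

theorem comap_residueHom {A : Type} [CommRing A] [IsLocalRing A] [Algebra ℂ A]
    (p : PrimeSpectrum (IsLocalRing.ResidueField A)) :
    PrimeSpectrum.comap (residueHom A).toRingHom p = IsLocalRing.closedPoint A := by
  have hp : p = IsLocalRing.closedPoint _ := Subsingleton.elim _ _
  rw [hp]
  exact IsLocalRing.comap_closedPoint (IsLocalRing.residue A)

theorem exists_mapAlgHom_comap_eq {M R S : Type} [AddCommMonoid M] [CommRing R] [Algebra ℂ R]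
    [CommRing S] [Algebra ℂ S] (f : R →ₐ[ℂ] S) (hf : Function.Surjective f)
    (hker : ∀ a, f a = 0 → IsNilpotent a) (p : PrimeSpectrum (AddMonoidAlgebra R M)) :
    ∃ p', PrimeSpectrum.comap (AddMonoidAlgebra.mapAlgHom M f).toRingHom p' = p := by
  have hs : Function.Surjective (AddMonoidAlgebra.mapAlgHom M f).toRingHom :=
    AddMonoidAlgebra.map_surjective (f : R →+ S) hf
  change p ∈ Set.range _
  rw [range_comap_of_surjective _ _ hs]
  intro g hg
  have h1 : ∀ m, f (g.coeff m) = 0 := fun m =>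
    congrArg (fun k : AddMonoidAlgebra S M => k.coeff m) hg
  rw [← AddMonoidAlgebra.sum_coeff_single g]
  refine Ideal.sum_mem _ fun m _ => ?_
  obtain ⟨k, hk⟩ := hker _ (h1 m)
  refine p.2.mem_of_pow_mem k ?_
  rw [AddMonoidAlgebra.single_pow, hk, AddMonoidAlgebra.single_zero]
  exact zero_mem _

section Chart

variable {T X : SchC} [GrpObj T] [ModObj T X] {x : X.left} {A : Type} [CommRing A] [IsLocalRing A]
    [Algebra ℂ A] (c : LocalChart X x A) {n : ℕ} {e : T ≅ affine (Lattice n)}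

theorem LocalChart.translation_apply (hx : ∀ t : affine ℂ ⟶ T,
    (affineMap (residueHom A) ≫ c.hom) ≫ translation X t = affineMap (residueHom A) ≫ c.hom)
    (t : affine ℂ ⟶ T) : (translation X t).left x = x := by
  have h1 : (affineMap (residueHom A) ≫ c.hom).left (IsLocalRing.closedPoint _) = x :=
    (congrArg c.hom.left (comap_residueHom (A := A) _)).trans c.apply_closedPoint
  have h2 := congrArg (fun k => k.left (IsLocalRing.closedPoint (IsLocalRing.ResidueField A)))
    (hx t)
  exact (congrArg (translation X t).left h1.symm).trans (h2.trans h1)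

/-- Modulo nilpotents A/m^k is the residue field, on which the orbit map is the projection. This
lets the orbit map of the thickening factor through `Spec A`. -/
theorem LocalChart.orbitMap_apply (hX : IsSeparated X.hom)
    (he : ∀ i, IsMonHom (e.hom ≫ affineMap (coordinate i) : T ⟶ Gm)) (hx : ∀ t : affine ℂ ⟶ T,
    (affineMap (residueHom A) ≫ c.hom) ≫ translation X t = affineMap (residueHom A) ≫ c.hom)
    (k : ℕ) (p : PrimeSpectrum (AddMonoidAlgebra (A ⧸ IsLocalRing.maximalIdeal A ^ k)
      (Fin n → ℤ))) :
    (orbitMap e (affineMap (Ideal.Quotient.mkₐ ℂ (IsLocalRing.maximalIdeal A ^ k)) ≫ c.hom)).left p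
      = x := by
  rcases Nat.eq_zero_or_pos k with rfl | hk
  · have h1 : Subsingleton (A ⧸ IsLocalRing.maximalIdeal A ^ 0) := by
      rw [Ideal.Quotient.subsingleton_iff, pow_zero, Ideal.one_eq_top]
    have h2 : (1 : AddMonoidAlgebra (A ⧸ IsLocalRing.maximalIdeal A ^ 0) (Fin n → ℤ)) = 0 := by
      ext
      exact Subsingleton.elim _ _
    exact absurd ((Ideal.eq_top_iff_one _).mpr (h2 ▸ p.asIdeal.zero_mem)) p.2.ne_top
  let f : A ⧸ IsLocalRing.maximalIdeal A ^ k →ₐ[ℂ] IsLocalRing.ResidueField A :=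
    Ideal.Quotient.factorₐ ℂ (Ideal.pow_le_self hk.ne')
  have hf : f.comp (Ideal.Quotient.mkₐ ℂ _) = residueHom A := rfl
  obtain ⟨p', rfl⟩ := exists_mapAlgHom_comap_eq f
    (Ideal.Quotient.factor_surjective (Ideal.pow_le_self hk.ne')) (fun a ha => by
      obtain ⟨a, rfl⟩ := Ideal.Quotient.mk_surjective a
      have h1 : a ∈ IsLocalRing.maximalIdeal A := Ideal.Quotient.eq_zero_iff_mem.mp ha
      exact ⟨k, Ideal.Quotient.eq_zero_iff_mem.mpr (Ideal.pow_mem_pow h1 k)⟩) p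
  have h1 := affineMap_mapAlgHom_comp_orbitMap e
    (affineMap (Ideal.Quotient.mkₐ ℂ (IsLocalRing.maximalIdeal A ^ k)) ≫ c.hom) f
  rw [← Category.assoc (affineMap f), ← affineMap_comp, hf, orbitMap_eq he hX _ hx] at h1
  have h2 := congrArg (fun k => k.left p') h1
  refine h2.trans (Eq.trans ?_ c.apply_closedPoint)
  exact congrArg c.hom.left (comap_residueHom _)

/-- A torus acts on the local ring at a fixed point. -/
theorem LocalChart.exists_weightAction (hX : IsSeparated X.hom)
    (he : ∀ i, IsMonHom (e.hom ≫ affineMap (coordinate i) : T ⟶ Gm)) (hx : ∀ t : affine ℂ ⟶ T,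
    (affineMap (residueHom A) ≫ c.hom) ≫ translation X t = affineMap (residueHom A) ≫ c.hom) :
    ∃ r : WeightAction (affine ℂ ⟶ T) (Fin n → ℤ) A, r.chr = charHom he ∧
      ∀ t, affineMap (r.act t) ≫ c.hom = c.hom ≫ translation X t := by
  have := c.mono
  have hlift : ∀ t : affine ℂ ⟶ T, ∃ f : A →ₐ[ℂ] A, affineMap f ≫ c.hom = c.hom ≫ translation X t :=
    fun t => c.exists_lift _ fun p => by
      have h1 := (c.specializes p).map (translation X t).left.continuous
      rw [c.translation_apply hx t] at h1
      exact h1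
  choose act hact using hlift
  have hres : ∀ t, (residueHom A).comp (act t) = residueHom A := by
    intro t
    apply affineMap_injective
    rw [← cancel_mono c.hom, affineMap_comp, Category.assoc, hact, ← Category.assoc, hx]
  refine ⟨⟨act, charHom he, ?_, ?_, ?_, ?_, ?_, ?_, ?_⟩, rfl, hact⟩
  · intro f
    have h : act 1 = AlgHom.id ℂ A := by
      apply affineMap_injective
      rw [← cancel_mono c.hom, hact, translation_one, affineMap_id, Category.comp_id,
        Category.id_comp]
    rw [h]
    rfl
  · intro t s f
    have h : act (t * s) = (act s).comp (act t) := by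
      apply affineMap_injective
      rw [← cancel_mono c.hom, hact, translation_mul, affineMap_comp, Category.assoc, hact,
        ← Category.assoc, ← Category.assoc, hact]
    rw [h]
    rfl
  · exact charValue_zero e
  · exact charValue_add e
  · exact charHom_injective he
  · intro f k
    let pr := Ideal.Quotient.mkₐ ℂ (IsLocalRing.maximalIdeal A ^ k)
    -- `φ` is the coaction A → (A/m^k)[ℤ^n]; the coefficients of `φ f` are the weight components of
    -- `f`.
    obtain ⟨φ, hφ⟩ := c.exists_lift (orbitMap e (affineMap pr ≫ c.hom)) fun p =>
      specializes_of_eq (c.orbitMap_apply hX he hx k p)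
    have h1 : ∀ t, (evalAt e _ t).comp φ = pr.comp (act t) := by
      intro t
      apply affineMap_injective
      rw [← cancel_mono c.hom, affineMap_comp, Category.assoc, hφ, affineMap_evalAt_comp_orbitMap,
        affineMap_comp, Category.assoc, Category.assoc, hact]
    refine ⟨(φ f).coeff.support, fun m => ((φ f).coeff m).out, fun t => ?_⟩
    rw [← Ideal.Quotient.eq_zero_iff_mem, map_sub, sub_eq_zero]
    have h2 := DFunLike.congr_fun (h1 t) f
    refine h2.symm.trans ?_
    rw [AlgHom.comp_apply, evalAt_apply, map_sum]
    refine Finset.sum_congr rfl fun m _ => ?_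
    have h3 : Ideal.Quotient.mk _ ((φ f).coeff m).out = (φ f).coeff m := Quotient.out_eq _
    refine Eq.trans ?_ (map_smul pr _ _).symm
    exact congrArg (charValue e m t • ·) h3.symm
  · intro t f
    rw [← Ideal.Quotient.eq_zero_iff_mem, map_sub, sub_eq_zero]
    exact DFunLike.congr_fun (hres t) f

end Chart

/-- The structure of a `ℂ`-algebra on a local ring of a scheme over `ℂ`. -/
noncomputable abbrev stalkAlgebra (X : SchC) (x : X.left) : Algebra ℂ (X.left.presheaf.stalk x) :=
  (Spec.preimage (X.left.fromSpecStalk x ≫ X.hom)).hom.toAlgebra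

attribute [local instance] stalkAlgebra

/-- The spectrum of the local ring at `x`, as a scheme over `ℂ` mapping to `X`. -/
noncomputable def stalkMap (X : SchC) (x : X.left) : affine (X.left.presheaf.stalk x) ⟶ X :=
  Over.homMk (X.left.fromSpecStalk x) (Spec.map_preimage (X.left.fromSpecStalk x ≫ X.hom)).symm

/-- The local ring of `X` at `x` presents the local scheme of `X` at `x`. -/
noncomputable def stalkChart (X : SchC) (x : X.left) :
    LocalChart X x (X.left.presheaf.stalk x) where
  hom := stalkMap X x
  mono := by
    have : Mono (stalkMap X x).left := inferInstanceAs (Mono (X.left.fromSpecStalk x))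
    exact (Over.forget _).mono_of_mono_map this
  specializes p := by
    have h : (stalkMap X x).left p ∈ Set.range (X.left.fromSpecStalk x) := ⟨p, rfl⟩
    rw [Scheme.range_fromSpecStalk] at h
    exact h
  apply_closedPoint := Scheme.fromSpecStalk_closedPoint
  exists_lift {R} _ _ ψ hψ := by
    obtain ⟨f, hf⟩ := exists_comp_fromSpecStalk (R := CommRingCat.of R) x ψ.left hψ
    have hfac : Spec.map f ≫ Spec.map (Spec.preimage (X.left.fromSpecStalk x ≫ X.hom)) =
        Spec.map (CommRingCat.ofHom (algebraMap ℂ R)) := by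
      rw [Spec.map_preimage, ← Category.assoc, hf]
      exact Over.w ψ
    rw [← Spec.map_comp] at hfac
    have hfac' := Spec.map_injective hfac
    refine ⟨⟨f.hom, fun r => congrArg (fun k => k.hom r) hfac'⟩, ?_⟩
    ext1
    exact hf

section FixedPoint

variable {T X : SchC} [GrpObj T] [ModObj T X] {x : X.left}

theorem residueHom_comp_translation (hx : IsFixedPoint T x) (t : affine ℂ ⟶ T) :
    (affineMap (residueHom (X.left.presheaf.stalk x)) ≫ (stalkChart X x).hom) ≫ translation X t =
      affineMap (residueHom (X.left.presheaf.stalk x)) ≫ (stalkChart X x).hom := by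
  ext1
  exact hx t

/-- The local scheme at `x` contains the generic point, so it is dense in the integral separated
scheme `X`. -/
theorem translation_eq_id (hX : IsVariety X) (t : affine ℂ ⟶ T)
    (h : stalkMap X x ≫ translation X t = stalkMap X x) : translation X t = 𝟙 X := by
  have := hX.isIntegral
  have := hX.isSeparated
  have : IsDominant (X.left.fromSpecStalk x) := by
    rw [isDominant_iff, denseRange_iff_closure_range, Set.eq_univ_iff_forall,
      Scheme.range_fromSpecStalk]
    intro y
    exact ((genericPoint_spec X.left).specializes trivial).mem_closed isClosed_closure
      (subset_closure ((genericPoint_spec X.left).specializes trivial))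
  ext1
  refine ext_of_isDominant_of_isSeparated X.hom ?_ (X.left.fromSpecStalk x) ?_
  · rw [Over.w]
    exact (Category.id_comp _).symm
  · exact (congrArg CommaMorphism.left h).trans (Category.comp_id _).symm

end FixedPoint

/-! ### A subtorus acting trivially -/

section Subtorus

variable {T : SchC} {n m : ℕ} (e : T ≅ affine (Lattice n)) (π : (Fin n → ℤ) →+ (Fin m → ℤ))

/-- The morphism of tori dual to a homomorphism of character lattices. -/
noncomputable def dualMap : affine (Lattice m) ⟶ T :=
  affineMap (AddMonoidAlgebra.mapDomainAlgHom ℂ ℂ π) ≫ e.inv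

theorem charValue_comp_dualMap (t : affine ℂ ⟶ affine (Lattice m)) (a : Fin n → ℤ) :
    charValue e a (t ≫ dualMap e π) = algHomOf t (AddMonoidAlgebra.single (π a) 1) := by
  rw [charValue, dualMap, Category.assoc, Category.assoc, e.inv_hom_id, Category.comp_id,
    algHomOf_comp, algHomOf_affineMap, AlgHom.comp_apply, AddMonoidAlgebra.mapDomainAlgHom_apply,
    AddMonoidAlgebra.mapDomain_single]

/-- A torus acting on a variety with a fixed point has a subtorus of codimension at most the
dimension of the local ring that acts trivially on points. -/
theorem exists_translation_dualMap_eq_id [GrpObj T] {X : SchC} [ModObj T X] {x : X.left}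
    {e : T ≅ affine (Lattice n)} (hX : IsVariety X)
    (he : ∀ i, IsMonHom (e.hom ≫ affineMap (coordinate i) : T ⟶ Gm)) (hx : IsFixedPoint T x) :
    ∃ (m d : ℕ) (π : (Fin n → ℤ) →+ (Fin m → ℤ)), Function.Surjective π ∧ m + d = n ∧
      (d : WithBot ℕ∞) ≤ ringKrullDim (X.left.presheaf.stalk x) ∧
      ∀ t, translation X (t ≫ dualMap e π) = 𝟙 X := by
  have := hX.isIntegral
  have := hX.locallyOfFiniteType
  have : IsLocallyNoetherian X.left := LocallyOfFiniteType.isLocallyNoetherian X.hom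
  obtain ⟨r, hr, hact⟩ := (stalkChart X x).exists_weightAction hX.isSeparated he
    (residueHom_comp_translation hx)
  obtain ⟨B, hB, hBd, hBt⟩ := r.exists_linearIndepOn_card_le
  obtain ⟨m, π, hπ, hm, hker⟩ := exists_surjective_of_linearIndepOn B hB
  refine ⟨m, B.card, π, hπ, hm, hBd, fun t => translation_eq_id (x := x) hX _ ?_⟩
  have h1 := hBt (t ≫ dualMap e π) fun a b hb hab => by
    rw [hr]
    change charValue e a (t ≫ dualMap e π) = 1
    rw [charValue_comp_dualMap, hker a b hb hab]
    exact map_one (algHomOf t)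
  have h2 : r.act (t ≫ dualMap e π) = AlgHom.id ℂ _ := AlgHom.ext h1
  have h3 := hact (t ≫ dualMap e π)
  rw [h2, affineMap_id, Category.id_comp] at h3
  exact h3.symm

end Subtorus

open scoped TensorProduct in
theorem isReduced_tensor_lattice (K : Type) [Field K] [Algebra ℂ K] (m : ℕ) :
    _root_.IsReduced (Lattice m ⊗[ℂ] K) := by
  have f := (Algebra.TensorProduct.comm ℂ (Lattice m) K).trans
    ((AddMonoidAlgebra.scalarTensorEquiv ℂ K (M := Fin m → ℤ)).restrictScalars ℂ)
  exact isReduced_of_injective f f.injective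

instance geometricallyReduced_lattice (m : ℕ) :
    GeometricallyReduced (affine (Lattice m)).hom := by
  rw [geometricallyReduced_iff]
  intro K _ i P f g h
  obtain ⟨φ, rfl⟩ := Spec.map_surjective i
  let := φ.hom.toAlgebra
  have h1 := isReduced_tensor_lattice K m
  have h2 : AlgebraicGeometry.IsReduced
      (Spec (CommRingCat.of (TensorProduct ℂ (Lattice m) K))) := inferInstance
  let k : P ≅ Spec (CommRingCat.of (TensorProduct ℂ (Lattice m) K)) :=
    h.isoPullback ≪≫ pullbackSpecIso ℂ (Lattice m) K
  exact isReduced_of_isOpenImmersion k.hom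

instance locallyOfFiniteType_lattice (m : ℕ) :
    LocallyOfFiniteType (affine (Lattice m)).hom := by
  have h : LocallyOfFiniteType
      (Spec.map (CommRingCat.ofHom (algebraMap ℂ (Lattice m)))) := by
    rw [HasRingHomProperty.Spec_iff (P := @LocallyOfFiniteType)]
    exact (RingHom.finiteType_algebraMap).mpr inferInstance
  exact h

/-- The product is reduced and locally of finite type over ℂ, so morphisms over ℂ to the separated
`X` are determined by the closed points, all of which are ℂ-points. -/
theorem whiskerRight_comp_smul_eq_snd {T X : SchC} [GrpObj T] [ModObj T X] (hX : IsVariety X)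
    {m : ℕ} (j : affine (Lattice m) ⟶ T)
    (hj : ∀ t : affine ℂ ⟶ affine (Lattice m), translation X (t ≫ j) = 𝟙 X) :
    j ▷ X ≫ (γ[T, X] : T ⊗ X ⟶ X) = snd (affine (Lattice m)) X := by
  have := hX.isIntegral
  have := hX.isSeparated
  have := hX.locallyOfFiniteType
  have : IsLocallyNoetherian X.left := LocallyOfFiniteType.isLocallyNoetherian X.hom
  let Y := affine (Lattice m) ⊗ X
  have hred : AlgebraicGeometry.IsReduced Y.left :=
    inferInstanceAs (AlgebraicGeometry.IsReduced
      (Limits.pullback (affine (Lattice m)).hom X.hom))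
  have hlft : LocallyOfFiniteType Y.hom :=
    inferInstanceAs (LocallyOfFiniteType
      (Limits.pullback.fst (affine (Lattice m)).hom X.hom ≫ (affine (Lattice m)).hom))
  let g : Y ⟶ X := j ▷ X ≫ (γ[T, X] : T ⊗ X ⟶ X)
  let s : Y ⟶ X := snd (affine (Lattice m)) X
  change g = s
  have hgs : ∀ w : affine ℂ ⟶ Y, w ≫ g = w ≫ s := by
    intro w
    have h1 := comp_translation (w ≫ s) ((w ≫ fst _ _) ≫ j)
    rw [hj, Category.comp_id, toPoint_unique (toPoint _) (𝟙 _), Category.id_comp] at h1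
    refine Eq.trans ?_ h1.symm
    change w ≫ j ▷ X ≫ _ = lift _ _ ≫ _
    rw [← Category.assoc]
    congr 1
    ext
    · simp
    · simp [s]
  have : LocallyOfFiniteType (g.left ≫ X.hom) := by
    rw [Over.w]
    exact hlft
  ext1
  refine ext_of_apply_eq (K := ℂ) X.hom Set.univ isOpen_univ.isLocallyClosed dense_univ
    (fun z _ hz => ?_) ((Over.w g).trans (Over.w s).symm)
  let w : affine ℂ ⟶ Y := Over.homMk (pointOfClosedPoint Y.hom z hz)
    ((pointOfClosedPoint_comp Y.hom z hz).trans affine_complex_hom.symm)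
  have h1 := congrArg (fun k => k.left (IsLocalRing.closedPoint ℂ)) (hgs w)
  have h2 : w.left (IsLocalRing.closedPoint ℂ) = z := pointOfClosedPoint_apply Y.hom z hz _
  exact (congrArg g.left h2.symm).trans (h1.trans (congrArg s.left h2))

theorem isClosedImmersion_dualMap {T : SchC} {n m : ℕ} (e : T ≅ affine (Lattice n))
    (π : (Fin n → ℤ) →+ (Fin m → ℤ)) (hπ : Function.Surjective π) :
    IsClosedImmersion (dualMap e π).left := by
  have h : Function.Surjective (AddMonoidAlgebra.mapDomainAlgHom ℂ ℂ π) := by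
    intro f
    induction f using AddMonoidAlgebra.induction_on with
    | of a =>
      obtain ⟨b, hb⟩ := hπ a
      exact ⟨AddMonoidAlgebra.single b 1, by
        rw [AddMonoidAlgebra.mapDomainAlgHom_apply, AddMonoidAlgebra.mapDomain_single, hb]; rfl⟩
    | add f g hf hg =>
      obtain ⟨f', rfl⟩ := hf
      obtain ⟨g', rfl⟩ := hg
      exact ⟨f' + g', map_add _ _ _⟩
    | smul r f hf =>
      obtain ⟨f', rfl⟩ := hf
      exact ⟨r • f', map_smul _ _ _⟩
  have h1 : IsClosedImmersion (affineMap (AddMonoidAlgebra.mapDomainAlgHom ℂ ℂ π)).left :=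
    IsClosedImmersion.spec_of_surjective
      (CommRingCat.ofHom (AddMonoidAlgebra.mapDomainAlgHom ℂ ℂ π).toRingHom) h
  have h2 : IsClosedImmersion e.inv.left :=
    inferInstanceAs (IsClosedImmersion ((Over.forget _).mapIso e).inv)
  exact IsClosedImmersion.comp _ _

/-- The image of a closed immersion through which the action becomes trivial acts trivially. -/
theorem actsTrivially_ker {T X H : SchC} [GrpObj T] [ModObj T X] (j : H ⟶ T)
    [IsClosedImmersion j.left] (h : j ▷ X ≫ (γ[T, X] : T ⊗ X ⟶ X) = snd H X) :
    ActsTrivially T X j.left.ker := by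
  have h1 : IsClosedImmersion.lift j.left j.left.ker.subschemeι
      (Scheme.IdealSheafData.ker_subschemeι _).ge ≫ j.left = j.left.ker.subschemeι :=
    IsClosedImmersion.lift_fac _ _ _
  let k : closedSubscheme j.left.ker ⟶ H := Over.homMk (IsClosedImmersion.lift j.left
    j.left.ker.subschemeι (Scheme.IdealSheafData.ker_subschemeι _).ge) (by
      refine (congrArg (IsClosedImmersion.lift j.left j.left.ker.subschemeι
        (Scheme.IdealSheafData.ker_subschemeι _).ge ≫ ·) (Over.w j).symm).trans ?_
      exact (Category.assoc _ _ _).symm.trans (congrArg (· ≫ T.hom) h1))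
  have hk : k ≫ j = closedInclusion j.left.ker := by
    ext1
    exact h1
  rw [ActsTrivially, ← hk, MonoidalCategory.comp_whiskerRight, Category.assoc, h, whiskerRight_snd]

/-! ### The dimension count -/

theorem topologicalKrullDim_eq_krullDim (Y : Scheme) : topologicalKrullDim Y = Order.krullDim Y :=
  Order.krullDim_eq_of_orderIso irreducibleSetEquivPoints

theorem height_le_height_apply {Y Z : Scheme} (f : Y ⟶ Z) (hf : Topology.IsInducing f) (y : Y) :
    Order.height y ≤ Order.height (f y) := by
  have h : ∀ a b : Y, f a ≤ f b ↔ a ≤ b := fun a b => hf.specializes_iff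
  exact Order.height_le_height_apply_of_strictMono f
    (fun a b hab => lt_of_le_not_ge ((h a b).mpr hab.le) fun hba => hab.not_ge ((h b a).mp hba)) y

theorem height_add_coheight_le {P : Type*} [Preorder P] (x : P) :
    ((Order.height x + Order.coheight x : ℕ∞) : WithBot ℕ∞) ≤ Order.krullDim P := by
  have : Nonempty P := ⟨x⟩
  rw [Order.krullDim_eq_iSup_height_add_coheight_of_nonempty, WithBot.coe_le_coe]
  exact le_iSup (fun a => Order.height a + Order.coheight a) x

theorem topologicalKrullDim_lattice (n : ℕ) :
    topologicalKrullDim (affine (Lattice n)).left = n :=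
  (PrimeSpectrum.topologicalKrullDim_eq_ringKrullDim (Lattice n)).trans
    (ringKrullDim_addMonoidAlgebra n)

theorem topologicalKrullDim_eq_of_iso {T : SchC} {n : ℕ} (e : T ≅ affine (Lattice n)) :
    topologicalKrullDim T.left = n := by
  have e' : T.left ≅ (affine (Lattice n)).left := (Over.forget _).mapIso e
  rw [← topologicalKrullDim_lattice n]
  exact IsHomeomorph.topologicalKrullDim_eq _ e'.hom.homeomorph.isHomeomorph

theorem le_topologicalKrullDim_subscheme {T : SchC} {m : ℕ} (j : affine (Lattice m) ⟶ T)
    [IsClosedImmersion j.left] (I : T.left.IdealSheafData) (hI : I ≤ j.left.ker) :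
    (m : WithBot ℕ∞) ≤ topologicalKrullDim I.subscheme := by
  rw [← topologicalKrullDim_lattice m]
  have h1 := IsClosedImmersion.lift_fac I.subschemeι j.left
    ((Scheme.IdealSheafData.ker_subschemeι I).le.trans hI)
  set f := IsClosedImmersion.lift I.subschemeι j.left
    ((Scheme.IdealSheafData.ker_subschemeι I).le.trans hI)
  have h2 : Topology.IsInducing (I.subschemeι ∘ f) := by
    have h3 : ⇑j.left = I.subschemeι ∘ f := by
      rw [← h1]
      rfl
    rw [← h3]
    exact j.left.isClosedEmbedding.isInducing
  exact (Topology.IsInducing.of_comp f.continuous I.subschemeι.continuous h2).topologicalKrullDim_le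

/-- The height of a point of the fixed point locus is bounded by the complexity of the action. -/
theorem height_add_le {T X : SchC} [GrpObj T] [ModObj T X] (hX : IsVariety X) {n : ℕ}
    (e : T ≅ affine (Lattice n))
    (he : ∀ i, IsMonHom (e.hom ≫ affineMap (coordinate i) : T ⟶ Gm))
    (y : (sInf {I : X.left.IdealSheafData | IsInvariant T X I}).subscheme) :
    ((Order.height y + n : ℕ∞) : WithBot ℕ∞) ≤ topologicalKrullDim X.left +
      topologicalKrullDim (sInf {I : T.left.IdealSheafData | ActsTrivially T X I}).subscheme := by
  have hx := isFixedPoint_subschemeι hX.isSeparated y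
  have hy := height_le_height_apply _ (Scheme.Hom.isClosedEmbedding
    (sInf {I : X.left.IdealSheafData | IsInvariant T X I}).subschemeι).isInducing y
  generalize (sInf {I : X.left.IdealSheafData | IsInvariant T X I}).subschemeι y = x at hx hy
  obtain ⟨m, d, π, hπ, hmd, hd, htr⟩ := exists_translation_dualMap_eq_id hX he hx
  have := isClosedImmersion_dualMap e π hπ
  -- Only the inclusion of the subtorus in the kernel is needed, so being below its ideal suffices.
  have hker := le_topologicalKrullDim_subscheme (dualMap e π)
    (sInf {I : T.left.IdealSheafData | ActsTrivially T X I})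
    (sInf_le (actsTrivially_ker (dualMap e π) (whiskerRight_comp_smul_eq_snd hX _ htr)))
  -- Generic points are the larger ones: the coheight of `x` is the dimension of its local ring, the
  -- height that of its closure.
  rw [ringKrullDim_stalk_eq_coheight] at hd
  have hd' : (d : ℕ∞) ≤ Order.coheight x := by exact_mod_cast hd
  have h1 := height_add_coheight_le x
  rw [← topologicalKrullDim_eq_krullDim] at h1
  have h2 : Order.height y + (n : ℕ∞) ≤ (Order.height x + Order.coheight x) + m := by
    rw [← hmd, Nat.cast_add, add_comm (m : ℕ∞), ← add_assoc]
    gcongr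
  calc ((Order.height y + n : ℕ∞) : WithBot ℕ∞)
      ≤ (((Order.height x + Order.coheight x) + m : ℕ∞) : WithBot ℕ∞) := by exact_mod_cast h2
    _ = ((Order.height x + Order.coheight x : ℕ∞) : WithBot ℕ∞) + (m : WithBot ℕ∞) := rfl
    _ ≤ _ := add_le_add h1 hker

/-- The subtrahend `n` is finite, so it can be moved across the inequality even if `b` or `c` is
infinite. -/
theorem coe_le_sub_add_coe {a b c : ℕ∞} {n : ℕ} (h : a + n ≤ b + c) :
    ((a : ENNReal) : EReal) ≤ ((b : ENNReal) : EReal) - (((n : ℕ∞) : ENNReal) : EReal) +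
      ((c : ENNReal) : EReal) := by
  have h1 : ((a : ENNReal) : EReal) + (((n : ℕ∞) : ENNReal) : EReal) ≤
      ((b : ENNReal) : EReal) + ((c : ENNReal) : EReal) := by
    rw [← EReal.coe_ennreal_add, ← EReal.coe_ennreal_add, EReal.coe_ennreal_le_coe_ennreal_iff]
    exact_mod_cast h
  have h2 : (((n : ℕ∞) : ENNReal) : EReal) = ((n : ℝ) : EReal) := by
    rw [ENat.toENNReal_coe, ← ENNReal.ofReal_natCast, EReal.coe_ennreal_ofReal,
      max_eq_left n.cast_nonneg]
  rw [h2] at h1 ⊢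
  rw [sub_eq_add_neg, add_right_comm, ← sub_eq_add_neg]
  exact (EReal.le_sub_iff_add_le (.inl (EReal.coe_ne_bot _)) (.inl (EReal.coe_ne_top _))).mpr h1

/-- A Krull dimension as an extended real. -/
noncomputable def ofKrullDim (d : WithBot ℕ∞) : EReal :=
  WithBot.recBotCoe ⊥ (fun d : ℕ∞ => ((d : ENNReal) : EReal)) d

/-- For empty `Y` the left side is `⊥`; otherwise a single point rules out `a = ⊥` and `k = ⊥`, and
the supremum over points gives the bound. -/
theorem ofKrullDim_le {Y : Scheme} {a k : WithBot ℕ∞} {n : ℕ}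
    (h : ∀ y : Y, ((Order.height y + n : ℕ∞) : WithBot ℕ∞) ≤ a + k) :
    ofKrullDim (topologicalKrullDim Y) ≤ ofKrullDim a - ofKrullDim n + ofKrullDim k := by
  rw [topologicalKrullDim_eq_krullDim]
  rcases isEmpty_or_nonempty Y with hemp | hne
  · rw [Order.krullDim_eq_bot]
    exact bot_le
  rw [Order.krullDim_eq_iSup_height_of_nonempty]
  induction a using WithBot.recBotCoe with
  | bot => exact absurd (h hne.some) (by simp)
  | coe a =>
    induction k using WithBot.recBotCoe with
    | bot => exact absurd (h hne.some) (by simp)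
    | coe k =>
      refine coe_le_sub_add_coe ?_
      rw [ENat.iSup_add]
      exact iSup_le fun y => by exact_mod_cast h y

end TorusAction

theorem mainTheorem5 (T X : TorusAction.SchC) [GrpObj T] (hT : TorusAction.IsTorus T)
    (hX : TorusAction.IsVariety X) [ModObj T X] :
    TorusAction.dim (TorusAction.fixedLocus T X) ≤ TorusAction.complexity T X := by
  obtain ⟨n, e, he⟩ := hT.exists_iso
  have h := TorusAction.ofKrullDim_le (TorusAction.height_add_le hX e he)
  rw [← TorusAction.topologicalKrullDim_eq_of_iso e] at h
  exact h
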